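/- Let $N\ge 1$ be an integer and $s\in(0,1)$. Let $\mathcal D^{s,2}_0(\mathbb R^N)$ be the completion of $C^\infty_0(\mathbb R^N)$ with respect to the norm whose square is $[u]^2=\int_{\mathbb R^N}\int_{\mathbb R^N}\frac{(u(x)-u(y))^2}{|x-y|^{N+2s}}\,dx\,dy$; a function $w$ is said to belong to it if there are $\varphi_n\in C^\infty_0(\mathbb R^N)$ with $[\varphi_n-w]\to0$ and $\varphi_n\to w$ almost everywhere. For $x_0\in\mathbb R^N$ and $\rho>0$ put $$\mathrm{Tail}(w,x_0,\rho)=\rho^{2s}\int_{\mathbb R^N\setminus B_\rho(x_0)}\frac{|w(x)|}{|x-x_0|^{N+2s}}\,dx .$$ There is a constant $C>0$, depending only on $N$ and $s$, with the following property. Let $U\subset\mathbb R^N$ be an open set, $x_0\in U$, $\delta\in(0,1]$, $0<r<\mathrm{dist}(x_0,\partial U)$ (where $\mathrm{dist}(x_0,\emptyset)=+\infty$), $f\in L^\infty(U)$, and let $w\in\mathcal D^{s,2}_0(\mathbb R^N)$ be a non-negative weak subsolution of $(-\Delta)^sw=f$ in $U$, i.e. $w\ge0$ a.e. in $U$ and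 $$\int_{\mathbb R^N}\int_{\mathbb R^N}\frac{(w(x)-w(y))(\varphi(x)-\varphi(y))}{|x-y|^{N+2s}}\,dx\,dy\le\int_U f\varphi\,dx\qquad\text{for all non-negative }\varphi\in C^\infty_0(U).$$ Then $$\operatorname*{ess\,sup}_{B_{r/2}(x_0)}w\le C\left[\delta\,\mathrm{Tail}(w,x_0,r/2)+\delta\,r^{2s}\|f\|_{L^\infty(U)}+\left(\frac1\delta\right)^{\frac{N}{4s}}\left(\frac{1}{|B_r(x_0)|}\int_{B_r(x_0)}w^2\,dx\right)^{\frac12}\right].$$ -/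

import Mathlib

open MeasureTheory Metric Filter Topology
open scoped ENNReal ContDiff

noncomputable section

/-- The singular kernel `|x - y|^{-(N+2s)}` of the fractional Laplacian on `ℝ^N`. -/
def fracKernel {N : ℕ} (s : ℝ) (x y : EuclideanSpace ℝ (Fin N)) : ℝ :=
  (‖x - y‖ ^ ((N : ℝ) + 2 * s))⁻¹

/-- The double integral `∫∫ (u(x) - u(y))² / |x - y|^{N+2s} dx dy`, with values in `[0, ∞]`. -/
def gagliardoEnergy {N : ℕ} (s : ℝ) (u : EuclideanSpace ℝ (Fin N) → ℝ) : ℝ≥0∞ :=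
  ∫⁻ p : EuclideanSpace ℝ (Fin N) × EuclideanSpace ℝ (Fin N),
    ENNReal.ofReal ((u p.1 - u p.2) ^ 2 * fracKernel s p.1 p.2)

/-- The bilinear form
`∫∫ (u(x) - u(y)) (φ(x) - φ(y)) / |x - y|^{N+2s} dx dy`. -/
def gagliardoForm {N : ℕ} (s : ℝ) (u φ : EuclideanSpace ℝ (Fin N) → ℝ) : ℝ :=
  ∫ p : EuclideanSpace ℝ (Fin N) × EuclideanSpace ℝ (Fin N),
    (u p.1 - u p.2) * (φ p.1 - φ p.2) * fracKernel s p.1 p.2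

/-- `φ ∈ C^∞_0(U)`: smooth functions with compact support contained in `U`. -/
def IsTestFunction {N : ℕ} (U : Set (EuclideanSpace ℝ (Fin N)))
    (φ : EuclideanSpace ℝ (Fin N) → ℝ) : Prop :=
  ContDiff ℝ ∞ φ ∧ HasCompactSupport φ ∧ tsupport φ ⊆ U

/-- The function `w` belongs to `D_0^{s,2}(ℝ^N)`, the completion of `C^∞_0(ℝ^N)` in the norm given
by the square root of `gagliardoEnergy`: it is the limit, in that norm and almost everywhere, of a
sequence of test functions. (Energy convergence alone would determine `w` only up to an additive
constant; the almost everywhere convergence selects the element of the completion.) -/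
def MemHomogeneousSobolev {N : ℕ} (s : ℝ) (w : EuclideanSpace ℝ (Fin N) → ℝ) : Prop :=
  ∃ φ : ℕ → EuclideanSpace ℝ (Fin N) → ℝ,
    (∀ n, IsTestFunction Set.univ (φ n)) ∧
    Tendsto (fun n => gagliardoEnergy s (φ n - w)) atTop (𝓝 0) ∧
    ∀ᵐ x, Tendsto (fun n => φ n x) atTop (𝓝 (w x))

/-- `w ∈ D_0^{s,2}(ℝ^N)` is a weak subsolution of `(-Δ)^s w = f` in `U`. -/
def IsWeakSubsolution {N : ℕ} (s : ℝ) (U : Set (EuclideanSpace ℝ (Fin N)))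
    (f w : EuclideanSpace ℝ (Fin N) → ℝ) : Prop :=
  MemHomogeneousSobolev s w ∧
    ∀ φ : EuclideanSpace ℝ (Fin N) → ℝ, IsTestFunction U φ → (∀ x, 0 ≤ φ x) →
      gagliardoForm s w φ ≤ ∫ x in U, f x * φ x

/-- The nonlocal tail
`Tail(w, x₀, ρ) = ρ^{2s} ∫_{ℝ^N ∖ B_ρ(x₀)} |w(x)| / |x - x₀|^{N+2s} dx`, with values in `[0, ∞]`. -/
def nonlocalTail {N : ℕ} (s : ℝ) (w : EuclideanSpace ℝ (Fin N) → ℝ)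
    (x₀ : EuclideanSpace ℝ (Fin N)) (ρ : ℝ) : ℝ≥0∞ :=
  ENNReal.ofReal (ρ ^ (2 * s)) *
    ∫⁻ x in (ball x₀ ρ)ᶜ, ENNReal.ofReal (|w x| * fracKernel s x x₀)

end

/-! ### Size, scaling and integrability of the kernel. -/

section Kernel

variable {N : ℕ} {s : ℝ}

/-! The proof is a De Giorgi iteration in which a fractional Faber-Krahn inequality plays the role
of the Sobolev embedding, so that no relation between `N` and `2s` matters.

Testing with `η² (w - k)₊` bounds the energy of `η (w - k)₊` by a source term and a nonlocal cross
term (`gagliardoEnergy_mul_posPart_le`). The cross term splits into a local part, controlled by the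
integral of `(w - k)₊²`, and a far part, controlled by the tail
(`lintegral_mul_mul_sq_sub_mul_fracKernel_le`). Conversely, if `u` lives on a set of measure at most
`κ σ^N`, with `κ` half the volume of the unit ball, then its energy is at least `κ σ^(-2s) ∫ u²`
(`lintegral_sq_le_gagliardoEnergy`). Chebyshev's inequality makes the superlevel sets small enough
for this; the result is `lintegral_posPart_sq_le_of_step`.

Iterate with levels `l (1 - 2^(-n))` and radii `(r/2)(1 + 2^(-n))`. If `l` is at least `δ` times
each of the tail and the scaled source, the energy constant is of order `r^(-2s) b^n / δ`. With
`σ^(2s)` proportional to `r^(2s) δ b^(-n)` the integrals decay like `q^n`, provided that the first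
is at most `θ δ^(N/(2s)) l² r^N`; hence `w ≤ l` on the half ball
(`exists_ae_le_of_lintegral_sq_le`). Taking square roots in this smallness condition produces the
factor `(1/δ)^(N/(4s))`.

Since only smooth test functions are admitted, `η² (w - k)₊` is reached in two limits: smooth
bounded truncations of the approximants of `w`, then removal of the upper truncation. -/

theorem fracKernel_nonneg (x y : EuclideanSpace ℝ (Fin N)) : 0 ≤ fracKernel s x y :=
  inv_nonneg.2 (Real.rpow_nonneg (norm_nonneg _) _)

theorem fracKernel_comm (x y : EuclideanSpace ℝ (Fin N)) :
    fracKernel s x y = fracKernel s y x := by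
  rw [fracKernel, fracKernel, norm_sub_rev]

theorem measurable_fracKernel :
    Measurable fun p : EuclideanSpace ℝ (Fin N) × EuclideanSpace ℝ (Fin N) =>
      fracKernel s p.1 p.2 := by
  unfold fracKernel
  fun_prop

/-- If `‖z - y‖ ≤ c ‖x - y‖`, the kernel at `(x, y)` is controlled by that at `(z, y)`. -/
theorem fracKernel_le_of_norm_sub_le (hs : 0 < s) {x y z : EuclideanSpace ℝ (Fin N)} {c : ℝ}
    (hc : 0 < c) (hz : z ≠ y) (h : ‖z - y‖ ≤ c * ‖x - y‖) :
    fracKernel s x y ≤ c ^ ((N : ℝ) + 2 * s) * fracKernel s z y := by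
  have hp : (0 : ℝ) < (N : ℝ) + 2 * s := by positivity
  have hzy : 0 < ‖z - y‖ := norm_pos_iff.2 (sub_ne_zero.2 hz)
  have hxy : 0 < ‖x - y‖ := pos_of_mul_pos_right (hzy.trans_le h) hc.le
  unfold fracKernel
  rw [← div_eq_mul_inv, le_div_iff₀ (by positivity), inv_mul_le_iff₀ (by positivity),
    mul_comm (‖x - y‖ ^ _), ← Real.mul_rpow hc.le hxy.le]
  exact Real.rpow_le_rpow hzy.le h hp.le

/-- In polar coordinates the radial integrand is `t ^ (1 - 2s)` near `0`, integrable as `s < 1`, and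
`t ^ (-1 - 2s)` at infinity, integrable as `s > 0`. -/
theorem integrable_min_sq_one_mul_rpow (hN : 1 ≤ N) (hs0 : 0 < s) (hs1 : s < 1) :
    Integrable fun z : EuclideanSpace ℝ (Fin N) =>
      min (‖z‖ ^ 2) 1 * (‖z‖ ^ ((N : ℝ) + 2 * s))⁻¹ := by
  have : Nonempty (Fin N) := ⟨⟨0, hN⟩⟩
  have hiff := integrable_fun_norm_addHaar (volume : Measure (EuclideanSpace ℝ (Fin N)))
    (f := fun t : ℝ => min (t ^ 2) 1 * (t ^ ((N : ℝ) + 2 * s))⁻¹)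
  rw [hiff, finrank_euclideanSpace_fin, ← Set.Ioc_union_Ioi_eq_Ioi zero_le_one]
  have key : ∀ t : ℝ, 0 < t → t ^ (N - 1) * (t ^ ((N : ℝ) + 2 * s))⁻¹ = t ^ (-1 - 2 * s) := by
    intro t ht
    rw [← Real.rpow_natCast, ← Real.rpow_neg ht.le, ← Real.rpow_add ht, Nat.cast_sub hN]
    congr 1
    push_cast
    ring
  refine IntegrableOn.union ?_ ?_
  · have h1 : IntegrableOn (fun t : ℝ => t ^ (1 - 2 * s)) (Set.Ioc 0 1) :=
      (intervalIntegrable_iff_integrableOn_Ioc_of_le zero_le_one).1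
        (intervalIntegral.intervalIntegrable_rpow' (by linarith))
    refine h1.congr_fun (fun t ht => ?_) measurableSet_Ioc
    have ht0 : 0 < t := ht.1
    have ht1 : t ^ 2 ≤ 1 := pow_le_one₀ ht0.le ht.2
    simp only [smul_eq_mul]
    rw [min_eq_left ht1, mul_left_comm, key t ht0, ← Real.rpow_natCast, ← Real.rpow_add ht0]
    congr 1
    push_cast
    ring
  · have h1 : IntegrableOn (fun t : ℝ => t ^ (-1 - 2 * s)) (Set.Ioi 1) :=
      integrableOn_Ioi_rpow_of_lt (by linarith) one_pos
    refine h1.congr_fun (fun t ht => ?_) measurableSet_Ioi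
    have ht1 : (1 : ℝ) < t := ht
    simp only [smul_eq_mul]
    rw [min_eq_right (one_le_pow₀ ht1.le), mul_left_comm, key t (by linarith), one_mul]

/-- Translation and the dilation by `r` reduce this to the case `x = 0`, `r = 1`. It gives the
natural size `r ^ (-2s)` of the energy density of a cutoff at scale `r`. -/
theorem exists_lintegral_min_mul_fracKernel_le (hN : 1 ≤ N) (hs0 : 0 < s) (hs1 : s < 1) :
    ∃ C : ℝ, 0 < C ∧ ∀ r : ℝ, 0 < r → ∀ x : EuclideanSpace ℝ (Fin N),
      ∫⁻ y, ENNReal.ofReal (min (‖x - y‖ ^ 2 / r ^ 2) 1 * fracKernel s x y)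
        ≤ ENNReal.ofReal (C * r ^ (-(2 * s))) := by
  set g : EuclideanSpace ℝ (Fin N) → ℝ :=
    fun z => min (‖z‖ ^ 2) 1 * (‖z‖ ^ ((N : ℝ) + 2 * s))⁻¹ with hg
  have hgi : Integrable g := integrable_min_sq_one_mul_rpow hN hs0 hs1
  have hg0 : ∀ z, 0 ≤ g z := fun z => by positivity
  refine ⟨(∫ z, g z) + 1, by have := integral_nonneg (μ := volume) (show 0 ≤ g from hg0); linarith,
    fun r hr x => ?_⟩
  have hscale : ∀ z : EuclideanSpace ℝ (Fin N),
      min (‖z‖ ^ 2 / r ^ 2) 1 * (‖z‖ ^ ((N : ℝ) + 2 * s))⁻¹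
        = r ^ (-((N : ℝ) + 2 * s)) * g (r⁻¹ • z) := by
    intro z
    simp only [hg, norm_smul, norm_inv, Real.norm_of_nonneg hr.le]
    rw [Real.mul_rpow (by positivity) (norm_nonneg z), Real.inv_rpow hr.le, Real.rpow_neg hr.le,
      mul_pow, inv_pow, mul_inv, inv_inv]
    have : r ^ ((N : ℝ) + 2 * s) ≠ 0 := (Real.rpow_pos_of_pos hr _).ne'
    rw [inv_mul_eq_div]
    field_simp
  have h1 : ∫⁻ y, ENNReal.ofReal (min (‖x - y‖ ^ 2 / r ^ 2) 1 * fracKernel s x y)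
      = ∫⁻ z : EuclideanSpace ℝ (Fin N),
        ENNReal.ofReal (r ^ (-((N : ℝ) + 2 * s)) * g (r⁻¹ • z)) := by
    simp_rw [← hscale]
    exact lintegral_sub_left_eq_self (μ := volume) (fun z : EuclideanSpace ℝ (Fin N) =>
      ENNReal.ofReal (min (‖z‖ ^ 2 / r ^ 2) 1 * (‖z‖ ^ ((N : ℝ) + 2 * s))⁻¹)) x
  rw [h1, ← ofReal_integral_eq_lintegral_ofReal
    ((hgi.comp_smul (inv_ne_zero hr.ne')).const_mul _)
    (Eventually.of_forall fun z => mul_nonneg (by positivity) (hg0 _)), integral_const_mul,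
    Measure.integral_comp_smul, finrank_euclideanSpace_fin]
  refine ENNReal.ofReal_le_ofReal ?_
  have hrr : r ^ (-((N : ℝ) + 2 * s)) * r ^ N = r ^ (-(2 * s)) := by
    rw [← Real.rpow_natCast, ← Real.rpow_add hr]
    congr 1
    ring
  have h2 : |(r⁻¹ ^ N)⁻¹| = r ^ N := by
    rw [inv_pow, inv_inv, abs_of_nonneg (by positivity)]
  rw [h2, smul_eq_mul, ← mul_assoc, hrr, mul_comm]
  gcongr
  linarith

/-- A bounded function of Lipschitz type has locally finite fractional energy density. -/
theorem lintegral_sq_sub_mul_fracKernel_le {C : ℝ} {r : ℝ} {x : EuclideanSpace ℝ (Fin N)}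
    (hC : ∫⁻ y, ENNReal.ofReal (min (‖x - y‖ ^ 2 / r ^ 2) 1 * fracKernel s x y)
        ≤ ENNReal.ofReal (C * r ^ (-(2 * s))))
    {η : EuclideanSpace ℝ (Fin N) → ℝ} {m : ℝ}
    (hη : ∀ y, (η x - η y) ^ 2 ≤ m * min (‖x - y‖ ^ 2 / r ^ 2) 1) (hm : 0 ≤ m) :
    ∫⁻ y, ENNReal.ofReal ((η x - η y) ^ 2 * fracKernel s x y)
      ≤ ENNReal.ofReal (m * (C * r ^ (-(2 * s)))) := by
  calc ∫⁻ y, ENNReal.ofReal ((η x - η y) ^ 2 * fracKernel s x y)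
      ≤ ∫⁻ y, ENNReal.ofReal m *
          ENNReal.ofReal (min (‖x - y‖ ^ 2 / r ^ 2) 1 * fracKernel s x y) := by
        refine lintegral_mono fun y => ?_
        rw [← ENNReal.ofReal_mul hm, ← mul_assoc]
        exact ENNReal.ofReal_le_ofReal
          (mul_le_mul_of_nonneg_right (hη y) (fracKernel_nonneg _ _))
    _ ≤ ENNReal.ofReal (m * (C * r ^ (-(2 * s)))) := by
        rw [lintegral_const_mul' _ _ ENNReal.ofReal_ne_top, ENNReal.ofReal_mul hm]
        gcongr

end Kernel

/-! ### Finiteness and elementary properties of the energy. -/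

section Energy

variable {N : ℕ} {s : ℝ}

/-- Tonelli: the inner integral is bounded uniformly in `x`, so any weight in one variable can be
pulled out. -/
theorem lintegral_fst_mul_sq_sub_mul_fracKernel_le {A : ℝ≥0∞}
    {a : EuclideanSpace ℝ (Fin N) → ℝ≥0∞} (ha : Measurable a)
    {η : EuclideanSpace ℝ (Fin N) → ℝ} (hηm : Measurable η)
    (hη : ∀ x, ∫⁻ y, ENNReal.ofReal ((η x - η y) ^ 2 * fracKernel s x y) ≤ A) :
    ∫⁻ p : EuclideanSpace ℝ (Fin N) × EuclideanSpace ℝ (Fin N),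
      a p.1 * ENNReal.ofReal ((η p.1 - η p.2) ^ 2 * fracKernel s p.1 p.2)
        ≤ (∫⁻ x, a x) * A := by
  have hK := measurable_fracKernel (N := N) (s := s)
  have hm : Measurable fun p : EuclideanSpace ℝ (Fin N) × EuclideanSpace ℝ (Fin N) =>
      ENNReal.ofReal ((η p.1 - η p.2) ^ 2 * fracKernel s p.1 p.2) := by fun_prop
  rw [Measure.volume_eq_prod, lintegral_prod _ (by fun_prop), ← lintegral_mul_const _ ha]
  refine lintegral_mono fun x => ?_
  simp only
  rw [lintegral_const_mul (a x) (f := fun y => ENNReal.ofReal ((η x - η y) ^ 2 * fracKernel s x y))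
    (hm.comp measurable_prodMk_left)]
  gcongr
  exact hη x

theorem lintegral_snd_mul_sq_sub_mul_fracKernel_le {A : ℝ≥0∞}
    {a : EuclideanSpace ℝ (Fin N) → ℝ≥0∞} (ha : Measurable a)
    {η : EuclideanSpace ℝ (Fin N) → ℝ} (hηm : Measurable η)
    (hη : ∀ x, ∫⁻ y, ENNReal.ofReal ((η x - η y) ^ 2 * fracKernel s x y) ≤ A) :
    ∫⁻ p : EuclideanSpace ℝ (Fin N) × EuclideanSpace ℝ (Fin N),
      a p.2 * ENNReal.ofReal ((η p.1 - η p.2) ^ 2 * fracKernel s p.1 p.2)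
        ≤ (∫⁻ x, a x) * A := by
  have h := lintegral_fst_mul_sq_sub_mul_fracKernel_le ha hηm hη
  rw [Measure.volume_eq_prod, ← lintegral_prod_swap, ← Measure.volume_eq_prod]
  refine le_trans (le_of_eq (lintegral_congr fun p => ?_)) h
  rw [Prod.fst_swap, Prod.snd_swap, fracKernel_comm,
    show (η p.2 - η p.1) ^ 2 = (η p.1 - η p.2) ^ 2 by ring]

theorem gagliardoEnergy_add_le {u v : EuclideanSpace ℝ (Fin N) → ℝ} (hu : Measurable u) :
    gagliardoEnergy s (u + v) ≤ 2 * gagliardoEnergy s u + 2 * gagliardoEnergy s v := by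
  have hK := measurable_fracKernel (N := N) (s := s)
  unfold gagliardoEnergy
  rw [← lintegral_const_mul' _ _ (by simp), ← lintegral_const_mul' _ _ (by simp),
    ← lintegral_add_left (by fun_prop)]
  refine lintegral_mono fun p => ?_
  have h2 : (2 : ℝ≥0∞) = ENNReal.ofReal 2 := by simp
  have hp := fracKernel_nonneg (s := s) p.1 p.2
  rw [h2, ← ENNReal.ofReal_mul (by norm_num), ← ENNReal.ofReal_mul (by norm_num),
    ← ENNReal.ofReal_add (by positivity) (by positivity)]
  refine ENNReal.ofReal_le_ofReal ?_
  simp only [Pi.add_apply]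
  nlinarith [mul_nonneg (sq_nonneg ((u p.1 - u p.2) - (v p.1 - v p.2))) hp]

theorem gagliardoEnergy_neg (u : EuclideanSpace ℝ (Fin N) → ℝ) :
    gagliardoEnergy s (-u) = gagliardoEnergy s u := by
  unfold gagliardoEnergy
  congr with p
  congr 2
  simp only [Pi.neg_apply]
  ring

theorem gagliardoEnergy_congr_ae {u v : EuclideanSpace ℝ (Fin N) → ℝ} (h : u =ᵐ[volume] v) :
    gagliardoEnergy s u = gagliardoEnergy s v := by
  refine lintegral_congr_ae ?_
  have h1 := (Measure.quasiMeasurePreserving_fst (μ := (volume : Measure (EuclideanSpace ℝ (Fin N))))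
    (ν := (volume : Measure (EuclideanSpace ℝ (Fin N))))).ae_eq_comp h
  have h2 := (Measure.quasiMeasurePreserving_snd (μ := (volume : Measure (EuclideanSpace ℝ (Fin N))))
    (ν := (volume : Measure (EuclideanSpace ℝ (Fin N))))).ae_eq_comp h
  filter_upwards [h1, h2] with p hp1 hp2
  simp only [Function.comp_apply] at hp1 hp2
  rw [hp1, hp2]

theorem gagliardoForm_congr_ae {u v φ : EuclideanSpace ℝ (Fin N) → ℝ} (h : u =ᵐ[volume] v) :
    gagliardoForm s u φ = gagliardoForm s v φ := by
  refine integral_congr_ae ?_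
  have h1 := (Measure.quasiMeasurePreserving_fst (μ := (volume : Measure (EuclideanSpace ℝ (Fin N))))
    (ν := (volume : Measure (EuclideanSpace ℝ (Fin N))))).ae_eq_comp h
  have h2 := (Measure.quasiMeasurePreserving_snd (μ := (volume : Measure (EuclideanSpace ℝ (Fin N))))
    (ν := (volume : Measure (EuclideanSpace ℝ (Fin N))))).ae_eq_comp h
  filter_upwards [h1, h2] with p hp1 hp2
  simp only [Function.comp_apply] at hp1 hp2
  rw [hp1, hp2]

/-- A Lipschitz function with values of size at most `M` has differences controlled by the
truncated distance. -/
theorem sq_sub_le_mul_min {η : EuclideanSpace ℝ (Fin N) → ℝ} {L M r : ℝ} (hr : 0 < r)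
    (hL : ∀ x y, |η x - η y| ≤ L * ‖x - y‖) (hM : ∀ x y, |η x - η y| ≤ M)
    {m : ℝ} (h1 : L ^ 2 * r ^ 2 ≤ m) (h2 : M ^ 2 ≤ m) (x y : EuclideanSpace ℝ (Fin N)) :
    (η x - η y) ^ 2 ≤ m * min (‖x - y‖ ^ 2 / r ^ 2) 1 := by
  rw [mul_min_of_nonneg _ _ ((sq_nonneg M).trans h2), mul_one]
  refine le_min ?_ ?_
  · rw [mul_div_assoc', le_div_iff₀ (by positivity), ← sq_abs]
    calc |η x - η y| ^ 2 * r ^ 2 ≤ (L * ‖x - y‖) ^ 2 * r ^ 2 := by gcongr; exact hL x y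
      _ = L ^ 2 * r ^ 2 * ‖x - y‖ ^ 2 := by ring
      _ ≤ _ := by gcongr
  · rw [← sq_abs]
    exact (pow_le_pow_left₀ (abs_nonneg _) (hM x y) 2).trans h2

theorem IsTestFunction.measurable {U : Set (EuclideanSpace ℝ (Fin N))}
    {φ : EuclideanSpace ℝ (Fin N) → ℝ} (hφ : IsTestFunction U φ) : Measurable φ :=
  hφ.1.continuous.measurable

theorem IsTestFunction.exists_lintegral_sq_sub_le (hN : 1 ≤ N) (hs0 : 0 < s) (hs1 : s < 1)
    {U : Set (EuclideanSpace ℝ (Fin N))} {φ : EuclideanSpace ℝ (Fin N) → ℝ}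
    (hφ : IsTestFunction U φ) :
    ∃ A : ℝ≥0∞, A < ⊤ ∧ ∀ x, ∫⁻ y, ENNReal.ofReal ((φ x - φ y) ^ 2 * fracKernel s x y) ≤ A := by
  obtain ⟨hc, hcs, -⟩ := hφ
  obtain ⟨C, hC0, hC⟩ := exists_lintegral_min_mul_fracKernel_le hN hs0 hs1
  obtain ⟨L, hL⟩ := ContDiff.lipschitzWith_of_hasCompactSupport hcs hc (by simp)
  obtain ⟨M, hM⟩ := hcs.exists_bound_of_continuous hc.continuous
  have hmin := sq_sub_le_mul_min (η := φ) (L := L) (M := 2 * M) one_pos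
    (fun x y => by simpa [Real.dist_eq, dist_eq_norm] using hL.dist_le_mul x y)
    (fun x y => by
      have h1 := hM x
      have h2 := hM y
      rw [Real.norm_eq_abs] at h1 h2
      have := abs_sub (φ x) (φ y)
      linarith)
    (le_add_of_nonneg_right (sq_nonneg _)) (le_add_of_nonneg_left (by positivity))
  exact ⟨_, ENNReal.ofReal_lt_top, fun x =>
    lintegral_sq_sub_mul_fracKernel_le (hC 1 one_pos x) (hmin x) (by positivity)⟩

/-- Only pairs with a point in the compact support contribute, and the energy density is uniformly
bounded there. -/
theorem gagliardoEnergy_lt_top_of_isTestFunction (hN : 1 ≤ N) (hs0 : 0 < s) (hs1 : s < 1)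
    {U : Set (EuclideanSpace ℝ (Fin N))} {φ : EuclideanSpace ℝ (Fin N) → ℝ}
    (hφ : IsTestFunction U φ) : gagliardoEnergy s φ < ⊤ := by
  obtain ⟨A, hAt, hA⟩ := hφ.exists_lintegral_sq_sub_le hN hs0 hs1
  have hφm : Measurable φ := hφ.measurable
  obtain ⟨hc, hcs, -⟩ := hφ
  have hK := measurable_fracKernel (N := N) (s := s)
  set a : EuclideanSpace ℝ (Fin N) → ℝ≥0∞ := (tsupport φ).indicator 1 with ha
  have ham : Measurable a := measurable_one.indicator (isClosed_tsupport φ).measurableSet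
  have hfin : (∫⁻ x, a x) * A < ⊤ := by
    rw [ha, lintegral_indicator_one (isClosed_tsupport φ).measurableSet]
    exact ENNReal.mul_lt_top hcs.isCompact.measure_lt_top hAt
  calc gagliardoEnergy s φ
      ≤ ∫⁻ p : EuclideanSpace ℝ (Fin N) × EuclideanSpace ℝ (Fin N),
        (a p.1 * ENNReal.ofReal ((φ p.1 - φ p.2) ^ 2 * fracKernel s p.1 p.2)
        + a p.2 * ENNReal.ofReal ((φ p.1 - φ p.2) ^ 2 * fracKernel s p.1 p.2)) := by
        refine lintegral_mono fun p => ?_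
        by_cases h1 : p.1 ∈ tsupport φ
        · simp only [ha, Set.indicator_of_mem h1, Pi.one_apply, one_mul]
          exact le_self_add
        by_cases h2 : p.2 ∈ tsupport φ
        · simp only [ha, Set.indicator_of_mem h2, Pi.one_apply, one_mul]
          exact le_add_self
        · simp [image_eq_zero_of_notMem_tsupport h1, image_eq_zero_of_notMem_tsupport h2]
    _ ≤ (∫⁻ x, a x) * A + (∫⁻ x, a x) * A := by
        rw [lintegral_add_left (by fun_prop)]
        exact add_le_add (lintegral_fst_mul_sq_sub_mul_fracKernel_le ham hφm hA)
          (lintegral_snd_mul_sq_sub_mul_fracKernel_le ham hφm hA)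
    _ < ⊤ := ENNReal.add_lt_top.2 ⟨hfin, hfin⟩

theorem gagliardoEnergy_lt_top_of_memHomogeneousSobolev (hN : 1 ≤ N) (hs0 : 0 < s) (hs1 : s < 1)
    {w : EuclideanSpace ℝ (Fin N) → ℝ} (hw : MemHomogeneousSobolev s w) :
    gagliardoEnergy s w < ⊤ := by
  obtain ⟨φ, hφ, hlim, -⟩ := hw
  obtain ⟨n, hn⟩ := (hlim.eventually_lt_const ENNReal.zero_lt_top).exists
  have h := gagliardoEnergy_add_le (s := s) (u := φ n) (v := -(φ n - w)) (hφ n).measurable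
  rw [gagliardoEnergy_neg, neg_sub, add_sub_cancel] at h
  refine h.trans_lt (ENNReal.add_lt_top.2 ⟨ENNReal.mul_lt_top (by simp) ?_,
    ENNReal.mul_lt_top (by simp) hn⟩)
  exact gagliardoEnergy_lt_top_of_isTestFunction hN hs0 hs1 (hφ n)

theorem MemHomogeneousSobolev.aemeasurable {w : EuclideanSpace ℝ (Fin N) → ℝ}
    (hw : MemHomogeneousSobolev s w) : AEMeasurable w := by
  obtain ⟨φ, hφ, -, hlim⟩ := hw
  exact aemeasurable_of_tendsto_metrizable_ae atTop (fun n => (hφ n).measurable.aemeasurable) hlim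

theorem MemHomogeneousSobolev.congr_ae {w v : EuclideanSpace ℝ (Fin N) → ℝ}
    (hw : MemHomogeneousSobolev s w) (h : w =ᵐ[volume] v) : MemHomogeneousSobolev s v := by
  obtain ⟨φ, hφ, hE, hlim⟩ := hw
  refine ⟨φ, hφ, hE.congr fun n => gagliardoEnergy_congr_ae ?_, ?_⟩
  · filter_upwards [h] with x hx
    simp [hx]
  · filter_upwards [h, hlim] with x hx hx'
    rwa [← hx]

end Energy

/-! ### A variant of dominated convergence. -/

section Limit

/-- Dominated convergence with an additional vanishing error in the domination. -/
theorem tendsto_integral_of_dominated_add {α : Type*} [MeasurableSpace α] {μ : Measure α}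
    {h d : ℕ → α → ℝ} {g F : α → ℝ} (hh : ∀ n, AEStronglyMeasurable (h n) μ)
    (hF : Integrable F μ) (hF0 : ∀ x, 0 ≤ F x) (hd : ∀ n, Integrable (d n) μ)
    (hd0 : ∀ n x, 0 ≤ d n x) (hdi : Tendsto (fun n => ∫ x, d n x ∂μ) atTop (𝓝 0))
    (hda : ∀ᵐ x ∂μ, Tendsto (fun n => d n x) atTop (𝓝 0))
    (hb : ∀ n, ∀ᵐ x ∂μ, |h n x| ≤ F x + d n x)
    (hlim : ∀ᵐ x ∂μ, Tendsto (fun n => h n x) atTop (𝓝 (g x))) :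
    Tendsto (fun n => ∫ x, h n x ∂μ) atTop (𝓝 (∫ x, g x ∂μ)) := by
  -- Clamping `h n` to `[-F, F]` gives a genuinely dominated sequence with the same limit, since the
  -- limit itself satisfies `|g| ≤ F`; the clamping error is at most `d n`.
  set c : ℕ → α → ℝ := fun n x => max (-F x) (min (F x) (h n x)) with hc
  have hcm : ∀ n, AEStronglyMeasurable (c n) μ := fun n =>
    hF.1.neg.sup (hF.1.inf (hh n))
  have hcF : ∀ n x, |c n x| ≤ F x := fun n x =>
    abs_le.2 ⟨le_max_left _ _, max_le (by linarith [hF0 x]) (min_le_left _ _)⟩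
  have hci : ∀ n, Integrable (c n) μ := fun n =>
    hF.mono' (hcm n) (Eventually.of_forall fun x => hcF n x)
  have hhi : ∀ n, Integrable (h n) μ := fun n =>
    (hF.add (hd n)).mono' (hh n) (hb n)
  have h1 : Tendsto (fun n => ∫ x, c n x ∂μ) atTop (𝓝 (∫ x, g x ∂μ)) := by
    refine tendsto_integral_of_dominated_convergence F hcm hF
      (fun n => Eventually.of_forall fun x => hcF n x) ?_
    filter_upwards [hlim, hda, ae_all_iff.2 hb] with x hx hdx hbx
    have hg : |g x| ≤ F x := by
      refine le_of_tendsto_of_tendsto' hx.abs ?_ hbx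
      simpa using hdx.const_add (F x)
    have h2 := (tendsto_const_nhds (x := -F x)).max ((tendsto_const_nhds (x := F x)).min hx)
    rwa [min_eq_right (abs_le.1 hg).2, max_eq_right (abs_le.1 hg).1] at h2
  have h2 : Tendsto (fun n => ∫ x, (h n x - c n x) ∂μ) atTop (𝓝 0) := by
    refine squeeze_zero_norm (fun n => ?_) hdi
    refine norm_integral_le_of_norm_le (hd n) ?_
    filter_upwards [hb n] with x hx
    have hx' := abs_le.1 hx
    have := hF0 x
    have := hd0 n x
    have h1 : h n x - d n x ≤ c n x :=
      (le_min (by linarith) (by linarith)).trans (le_max_right _ _)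
    have h2 : c n x ≤ h n x + d n x :=
      max_le (by linarith) ((min_le_right _ _).trans (by linarith))
    exact abs_le.2 ⟨by linarith, by linarith⟩
  have h3 := h1.add h2
  rw [add_zero] at h3
  refine h3.congr fun n => ?_
  rw [integral_sub (hhi n) (hci n)]
  ring

end Limit

/-! ### Smooth truncations with bounds uniform in the smoothing parameter. -/

section SmoothTruncation

/-- A smooth approximation, as `ε → 0`, of the truncation of `t - k` to the interval `[0, M]`. -/
noncomputable def smoothTrunc (k M ε t : ℝ) : ℝ :=
  (√((t - k) ^ 2 + ε ^ 2) - √((t - k - M) ^ 2 + ε ^ 2) + M) / 2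

/-- This is the reverse triangle inequality for the plane vectors `(a, ε)` and `(b, ε)`. -/
theorem abs_sqrt_sq_add_sub_le (a b ε : ℝ) :
    |√(a ^ 2 + ε ^ 2) - √(b ^ 2 + ε ^ 2)| ≤ |a - b| := by
  have key : ∀ a b : ℝ, √(a ^ 2 + ε ^ 2) ≤ |a - b| + √(b ^ 2 + ε ^ 2) := by
    intro a b
    have hS := Real.sq_sqrt (show 0 ≤ b ^ 2 + ε ^ 2 by positivity)
    have hb : |b| ≤ √(b ^ 2 + ε ^ 2) := Real.abs_le_sqrt (by nlinarith)
    rw [Real.sqrt_le_left (by positivity), add_sq, hS, sq_abs]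
    have h1 : (a - b) * b ≤ |a - b| * √(b ^ 2 + ε ^ 2) := by
      calc (a - b) * b ≤ |(a - b) * b| := le_abs_self _
        _ = |a - b| * |b| := abs_mul _ _
        _ ≤ _ := by gcongr
    nlinarith
  have h1 := key a b
  have h2 := key b a
  rw [abs_sub_comm] at h2
  exact abs_le.2 ⟨by linarith, by linarith⟩

theorem smoothTrunc_nonneg {k M : ℝ} (hM : 0 ≤ M) (ε t : ℝ) : 0 ≤ smoothTrunc k M ε t := by
  have h := abs_le.1 (abs_sqrt_sq_add_sub_le (t - k) (t - k - M) ε)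
  rw [show t - k - (t - k - M) = M by ring, abs_of_nonneg hM] at h
  unfold smoothTrunc
  linarith [h.1]

theorem smoothTrunc_le {k M : ℝ} (hM : 0 ≤ M) (ε t : ℝ) : smoothTrunc k M ε t ≤ M := by
  have h := abs_le.1 (abs_sqrt_sq_add_sub_le (t - k) (t - k - M) ε)
  rw [show t - k - (t - k - M) = M by ring, abs_of_nonneg hM] at h
  unfold smoothTrunc
  linarith [h.2]

theorem abs_smoothTrunc_sub_le (k M ε t u : ℝ) :
    |smoothTrunc k M ε t - smoothTrunc k M ε u| ≤ |t - u| := by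
  have h1 := abs_sqrt_sq_add_sub_le (t - k) (u - k) ε
  have h2 := abs_sqrt_sq_add_sub_le (t - k - M) (u - k - M) ε
  rw [show t - k - (u - k) = t - u by ring] at h1
  rw [show t - k - M - (u - k - M) = t - u by ring] at h2
  have h1' := abs_le.1 h1
  have h2' := abs_le.1 h2
  unfold smoothTrunc
  exact abs_le.2 ⟨by linarith, by linarith⟩

theorem contDiff_smoothTrunc (k M : ℝ) {ε : ℝ} (hε : 0 < ε) :
    ContDiff ℝ ∞ (smoothTrunc k M ε) := by
  unfold smoothTrunc
  have h1 : ContDiff ℝ ∞ fun t : ℝ => √((t - k) ^ 2 + ε ^ 2) :=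
    ContDiff.sqrt (by fun_prop) fun t => by positivity
  have h2 : ContDiff ℝ ∞ fun t : ℝ => √((t - k - M) ^ 2 + ε ^ 2) :=
    ContDiff.sqrt (by fun_prop) fun t => by positivity
  exact ((h1.sub h2).add contDiff_const).div_const _

/-- At `ε = 0` the roots become absolute values, and `(|t - k| - |t - k - M| + M) / 2` is the clamp
of `t - k` to `[0, M]`. -/
theorem smoothTrunc_zero {k M : ℝ} (hM : 0 ≤ M) (t : ℝ) :
    smoothTrunc k M 0 t = max 0 (min (t - k) M) := by
  unfold smoothTrunc
  rw [zero_pow two_ne_zero, add_zero, add_zero, Real.sqrt_sq_eq_abs, Real.sqrt_sq_eq_abs]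
  rcases le_total (t - k) 0 with h | h
  · rw [abs_of_nonpos h, abs_of_nonpos (by linarith), max_eq_left ((min_le_left _ _).trans h)]
    ring
  rcases le_total (t - k) M with h' | h'
  · rw [abs_of_nonneg h, abs_of_nonpos (by linarith), min_eq_left h', max_eq_right h]
    ring
  · rw [abs_of_nonneg h, abs_of_nonneg (by linarith), min_eq_right h', max_eq_right hM]
    ring

theorem tendsto_smoothTrunc {k M : ℝ} (hM : 0 ≤ M) {ε t : ℕ → ℝ} {t₀ : ℝ}
    (hε : Tendsto ε atTop (𝓝 0)) (ht : Tendsto t atTop (𝓝 t₀)) :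
    Tendsto (fun n => smoothTrunc k M (ε n) (t n)) atTop (𝓝 (max 0 (min (t₀ - k) M))) := by
  have hc : Continuous fun p : ℝ × ℝ => smoothTrunc k M p.1 p.2 := by
    unfold smoothTrunc
    fun_prop
  have h := hc.continuousAt.tendsto.comp (hε.prodMk_nhds ht)
  simp only [smoothTrunc_zero hM] at h
  exact h

end SmoothTruncation

/-! ### Testing with bounded truncations. -/

section Testing

variable {N : ℕ} {s : ℝ}

/-- The asymmetry is deliberate: the increment of the cutoff is weighted by only one of the two
function values. -/
theorem abs_mul_sub_mul_le {a b c d : ℝ} (ha0 : 0 ≤ a) (ha1 : a ≤ 1) (hd : 0 ≤ d) :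
    |a * c - b * d| ≤ |c - d| + d * |a - b| := by
  calc |a * c - b * d| = |a * (c - d) + d * (a - b)| := by ring_nf
    _ ≤ |a * (c - d)| + |d * (a - b)| := abs_add_le _ _
    _ = a * |c - d| + d * |a - b| := by rw [abs_mul, abs_mul, abs_of_nonneg ha0, abs_of_nonneg hd]
    _ ≤ 1 * |c - d| + d * |a - b| := by gcongr
    _ = _ := by rw [one_mul]

theorem integrable_sq_sub_mul_fracKernel {u : EuclideanSpace ℝ (Fin N) → ℝ} (hu : Measurable u)
    (hE : gagliardoEnergy s u < ⊤) :
    Integrable fun p : EuclideanSpace ℝ (Fin N) × EuclideanSpace ℝ (Fin N) =>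
      (u p.1 - u p.2) ^ 2 * fracKernel s p.1 p.2 := by
  have hK := measurable_fracKernel (N := N) (s := s)
  refine ⟨by fun_prop, ?_⟩
  rw [hasFiniteIntegral_iff_ofReal]
  · exact hE
  · exact Eventually.of_forall fun p => mul_nonneg (sq_nonneg _) (fracKernel_nonneg _ _)

theorem integrable_abs_mul_abs_mul {α : Type*} [MeasurableSpace α] {μ : Measure α}
    {f g K : α → ℝ} (hf : Measurable f) (hg : Measurable g) (hK : Measurable K)
    (hK0 : ∀ x, 0 ≤ K x) (hfi : Integrable (fun x => f x ^ 2 * K x) μ)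
    (hgi : Integrable (fun x => g x ^ 2 * K x) μ) :
    Integrable (fun x => |f x| * |g x| * K x) μ := by
  refine (hfi.add hgi).mono' (by fun_prop) (Eventually.of_forall fun x => ?_)
  have := hK0 x
  rw [Real.norm_of_nonneg (by positivity), Pi.add_apply, ← add_mul]
  gcongr
  rw [← sq_abs (f x), ← sq_abs (g x)]
  nlinarith [sq_nonneg (|f x| - |g x|), sq_nonneg (|f x|), sq_nonneg (|g x|)]

/-- Cauchy-Schwarz, with the weight `K` split as `√K * √K`. -/
theorem tendsto_integral_abs_mul_abs_mul {α : Type*} [MeasurableSpace α] {μ : Measure α}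
    {f K : α → ℝ} {g : ℕ → α → ℝ} (hf : Measurable f) (hg : ∀ n, Measurable (g n))
    (hK : Measurable K) (hK0 : ∀ x, 0 ≤ K x)
    (hfi : ∫⁻ x, ENNReal.ofReal (f x ^ 2 * K x) ∂μ < ⊤)
    (hgi : Tendsto (fun n => ∫⁻ x, ENNReal.ofReal (g n x ^ 2 * K x) ∂μ) atTop (𝓝 0)) :
    Tendsto (fun n => ∫ x, |f x| * |g n x| * K x ∂μ) atTop (𝓝 0) := by
  have hsq : ∀ u : α → ℝ, ∀ x, ENNReal.ofReal (|u x| * √(K x)) ^ (2 : ℝ)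
      = ENNReal.ofReal (u x ^ 2 * K x) := fun u x => by
    rw [ENNReal.rpow_two, ← ENNReal.ofReal_pow (by positivity), mul_pow, sq_abs,
      Real.sq_sqrt (hK0 x)]
  have hle : ∀ n, ∫⁻ x, ENNReal.ofReal (|f x| * |g n x| * K x) ∂μ
      ≤ (∫⁻ x, ENNReal.ofReal (f x ^ 2 * K x) ∂μ) ^ (1 / 2 : ℝ)
        * (∫⁻ x, ENNReal.ofReal (g n x ^ 2 * K x) ∂μ) ^ (1 / 2 : ℝ) := fun n => by
    have h := ENNReal.lintegral_mul_le_Lp_mul_Lq μ Real.HolderConjugate.two_two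
      (f := fun x => ENNReal.ofReal (|f x| * √(K x)))
      (g := fun x => ENNReal.ofReal (|g n x| * √(K x)))
      (by fun_prop) (by have := hg n; fun_prop)
    simp only [hsq, Pi.mul_apply] at h
    refine le_trans (le_of_eq (lintegral_congr fun x => ?_)) h
    rw [← ENNReal.ofReal_mul (by positivity)]
    congr 1
    nth_rewrite 1 [← Real.mul_self_sqrt (hK0 x)]
    ring
  have hlim : Tendsto (fun n => ∫⁻ x, ENNReal.ofReal (|f x| * |g n x| * K x) ∂μ) atTop (𝓝 0) := by
    refine tendsto_of_tendsto_of_tendsto_of_le_of_le tendsto_const_nhds ?_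
      (fun n => zero_le) hle
    have h1 := (ENNReal.continuous_rpow_const (y := (1 / 2 : ℝ))).tendsto 0 |>.comp hgi
    rw [ENNReal.zero_rpow_of_pos (by norm_num)] at h1
    have h2 := ENNReal.Tendsto.const_mul h1 (Or.inr
      (ENNReal.rpow_ne_top_of_nonneg (y := (1 / 2 : ℝ)) (by norm_num) hfi.ne))
    rwa [mul_zero] at h2
  have h3 := (ENNReal.tendsto_toReal ENNReal.zero_ne_top).comp hlim
  rw [ENNReal.toReal_zero] at h3
  refine h3.congr fun n => ?_
  rw [integral_eq_lintegral_of_nonneg_ae]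
  · rfl
  · exact Eventually.of_forall fun x => by have := hK0 x; positivity
  · have := hg n
    fun_prop

variable {U : Set (EuclideanSpace ℝ (Fin N))} {w q : EuclideanSpace ℝ (Fin N) → ℝ} {F k : ℝ}

/-- A subsolution may be tested with a cutoff of a bounded truncation of itself. -/
theorem gagliardoForm_mul_truncation_le (hN : 1 ≤ N) (hs0 : 0 < s) (hs1 : s < 1)
    (hwm : Measurable w) (hw : MemHomogeneousSobolev s w)
    (hsub : ∀ φ : EuclideanSpace ℝ (Fin N) → ℝ, IsTestFunction U φ → (∀ x, 0 ≤ φ x) →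
      gagliardoForm s w φ ≤ F * ∫ x, φ x)
    (hq : IsTestFunction U q) (hq0 : ∀ x, 0 ≤ q x) (hq1 : ∀ x, q x ≤ 1) {M : ℝ} (hM : 0 ≤ M) :
    gagliardoForm s w (fun x => q x * max 0 (min (w x - k) M))
      ≤ F * ∫ x, q x * max 0 (min (w x - k) M) := by
  have hwE := gagliardoEnergy_lt_top_of_memHomogeneousSobolev hN hs0 hs1 hw
  have hqE := gagliardoEnergy_lt_top_of_isTestFunction hN hs0 hs1 hq
  obtain ⟨φ, hφ, hE, hlim⟩ := hw
  have hK := measurable_fracKernel (N := N) (s := s)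
  have hK0 : ∀ p : EuclideanSpace ℝ (Fin N) × EuclideanSpace ℝ (Fin N),
    0 ≤ fracKernel s p.1 p.2 := fun p => fracKernel_nonneg _ _
  have hqm := hq.measurable
  set ε : ℕ → ℝ := fun n => 1 / ((n : ℝ) + 1) with hε
  have hε0 : ∀ n, 0 < ε n := fun n => by positivity
  have hεlim : Tendsto ε atTop (𝓝 0) := tendsto_one_div_add_atTop_nhds_zero_nat
  -- The truncation is applied to the smooth approximant `φ n` rather than to `w`, so that `ψ n` is
  -- an admissible test function.
  set ψ : ℕ → EuclideanSpace ℝ (Fin N) → ℝ :=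
    fun n x => q x * smoothTrunc k M (ε n) (φ n x) with hψ
  have hψt : ∀ n, IsTestFunction U (ψ n) := fun n =>
    ⟨hq.1.mul ((contDiff_smoothTrunc k M (hε0 n)).comp (hφ n).1), hq.2.1.mul_right,
      (tsupport_mul_subset_left).trans hq.2.2⟩
  have hψ0 : ∀ n x, 0 ≤ ψ n x := fun n x => mul_nonneg (hq0 x) (smoothTrunc_nonneg hM _ _)
  have hψlim : ∀ᵐ x, Tendsto (fun n => ψ n x) atTop (𝓝 (q x * max 0 (min (w x - k) M))) := by
    filter_upwards [hlim] with x hx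
    exact (tendsto_smoothTrunc hM hεlim hx).const_mul _
  have hψm : ∀ n, Measurable (ψ n) := fun n => (hψt n).measurable
  have hlhs : Tendsto (fun n => gagliardoForm s w (ψ n)) atTop
      (𝓝 (gagliardoForm s w (fun x => q x * max 0 (min (w x - k) M)))) := by
    have hdm : ∀ n, Measurable (φ n - w) := fun n => (hφ n).measurable.sub hwm
    have hdE : ∀ n, gagliardoEnergy s (φ n - w) < ⊤ := fun n => by
      rw [sub_eq_add_neg]
      refine (gagliardoEnergy_add_le (hφ n).measurable).trans_lt ?_
      rw [gagliardoEnergy_neg]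
      exact ENNReal.add_lt_top.2 ⟨ENNReal.mul_lt_top (by simp)
        (gagliardoEnergy_lt_top_of_isTestFunction hN hs0 hs1 (hφ n)),
        ENNReal.mul_lt_top (by simp) hwE⟩
    have hwi := integrable_sq_sub_mul_fracKernel hwm hwE
    have hqi := integrable_sq_sub_mul_fracKernel hqm hqE
    -- The increment of `ψ n` is at most `M |δq| + |δw| + |δ(φ n - w)|`, writing `δ` for increments.
    -- Multiplied by `|δw|`, the first two terms are a fixed integrable majorant; the third tends to
    -- zero in mean by convergence in energy.
    refine tendsto_integral_of_dominated_add
      (F := fun p => M * (|w p.1 - w p.2| * |q p.1 - q p.2| * fracKernel s p.1 p.2)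
        + (w p.1 - w p.2) ^ 2 * fracKernel s p.1 p.2)
      (d := fun n p => |w p.1 - w p.2| * |(φ n - w) p.1 - (φ n - w) p.2| * fracKernel s p.1 p.2)
      (fun n => ?_) ?_ (fun p => ?_) (fun n => ?_) (fun n p => ?_) ?_ ?_ (fun n => ?_) ?_
    · have := hψm n
      exact Measurable.aestronglyMeasurable (by fun_prop)
    · exact ((integrable_abs_mul_abs_mul (by fun_prop) (by fun_prop) hK hK0 hwi hqi).const_mul
        M).add hwi
    · have := hK0 p
      positivity
    · have := hdm n
      exact integrable_abs_mul_abs_mul (by fun_prop) (by fun_prop) hK hK0 hwi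
        (integrable_sq_sub_mul_fracKernel (hdm n) (hdE n))
    · have := hK0 p
      positivity
    · exact tendsto_integral_abs_mul_abs_mul (by fun_prop)
        (fun n => by have := hdm n; fun_prop) hK hK0 hwE hE
    · have h1 := (Measure.quasiMeasurePreserving_fst (μ := (volume : Measure (EuclideanSpace ℝ (Fin N))))
        (ν := (volume : Measure (EuclideanSpace ℝ (Fin N))))).ae hlim
      have h2 := (Measure.quasiMeasurePreserving_snd (μ := (volume : Measure (EuclideanSpace ℝ (Fin N))))
        (ν := (volume : Measure (EuclideanSpace ℝ (Fin N))))).ae hlim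
      filter_upwards [h1, h2] with p hp1 hp2
      have h3 := (((hp1.sub_const (w p.1)).sub (hp2.sub_const (w p.2))).abs.const_mul
        (|w p.1 - w p.2|)).mul_const (fracKernel s p.1 p.2)
      simpa using h3
    · refine Eventually.of_forall fun p => ?_
      have hKp := hK0 p
      have h1 : |ψ n p.1 - ψ n p.2| ≤ M * |q p.1 - q p.2| + |w p.1 - w p.2|
          + |(φ n - w) p.1 - (φ n - w) p.2| := by
        have h2 := abs_mul_sub_mul_le (a := q p.1) (b := q p.2)
          (c := smoothTrunc k M (ε n) (φ n p.1)) (d := smoothTrunc k M (ε n) (φ n p.2))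
          (hq0 _) (hq1 _) (smoothTrunc_nonneg hM _ _)
        have h3 := abs_smoothTrunc_sub_le k M (ε n) (φ n p.1) (φ n p.2)
        have h4 : smoothTrunc k M (ε n) (φ n p.2) * |q p.1 - q p.2| ≤ M * |q p.1 - q p.2| :=
          mul_le_mul_of_nonneg_right (smoothTrunc_le hM _ _) (abs_nonneg _)
        have h5 : |φ n p.1 - φ n p.2| ≤ |w p.1 - w p.2|
            + |(φ n - w) p.1 - (φ n - w) p.2| := by
          refine le_trans (le_of_eq ?_) (abs_add_le _ _)
          simp only [Pi.sub_apply]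
          ring_nf
        linarith
      rw [abs_mul, abs_mul, abs_of_nonneg hKp]
      calc |w p.1 - w p.2| * |ψ n p.1 - ψ n p.2| * fracKernel s p.1 p.2
          ≤ |w p.1 - w p.2| * (M * |q p.1 - q p.2| + |w p.1 - w p.2|
            + |(φ n - w) p.1 - (φ n - w) p.2|) * fracKernel s p.1 p.2 := by gcongr
        _ = _ := by
          rw [← sq_abs (w p.1 - w p.2)]
          ring
    · have h1 := (Measure.quasiMeasurePreserving_fst (μ := (volume : Measure (EuclideanSpace ℝ (Fin N))))
        (ν := (volume : Measure (EuclideanSpace ℝ (Fin N))))).ae hψlim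
      have h2 := (Measure.quasiMeasurePreserving_snd (μ := (volume : Measure (EuclideanSpace ℝ (Fin N))))
        (ν := (volume : Measure (EuclideanSpace ℝ (Fin N))))).ae hψlim
      filter_upwards [h1, h2] with p hp1 hp2
      exact ((hp1.sub hp2).const_mul _).mul_const _
  have hrhs : Tendsto (fun n => ∫ x, ψ n x) atTop
      (𝓝 (∫ x, q x * max 0 (min (w x - k) M))) := by
    refine tendsto_integral_of_dominated_convergence (fun x => q x * M)
      (fun n => (hψm n).aestronglyMeasurable)
      ((hq.1.continuous.integrable_of_hasCompactSupport hq.2.1).mul_const M)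
      (fun n => Eventually.of_forall fun x => ?_) hψlim
    rw [Real.norm_of_nonneg (hψ0 n x)]
    exact mul_le_mul_of_nonneg_left (smoothTrunc_le hM _ _) (hq0 x)
  exact le_of_tendsto_of_tendsto' hlhs (hrhs.const_mul F) fun n => hsub _ (hψt n) (hψ0 n)

end Testing

/-! ### Testing with the positive part above a level, and the energy bound it yields. -/

section Testing

variable {N : ℕ} {s : ℝ}
variable {U : Set (EuclideanSpace ℝ (Fin N))} {w q : EuclideanSpace ℝ (Fin N) → ℝ} {F k : ℝ}

theorem abs_trunc_sub_le (k M a b : ℝ) :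
    |max 0 (min (a - k) M) - max 0 (min (b - k) M)| ≤ |a - b| := by
  refine (abs_max_sub_max_le_max _ _ _ _).trans (max_le (by simp) ?_)
  refine (abs_min_sub_min_le_max _ _ _ _).trans (max_le ?_ (by simp))
  rw [sub_sub_sub_cancel_right]

/-- A locally square integrable subsolution may be tested with a cutoff of its positive part above
a level `k`. -/
theorem gagliardoForm_mul_posPart_le (hN : 1 ≤ N) (hs0 : 0 < s) (hs1 : s < 1)
    (hwm : Measurable w) (hw : MemHomogeneousSobolev s w)
    (hsub : ∀ φ : EuclideanSpace ℝ (Fin N) → ℝ, IsTestFunction U φ → (∀ x, 0 ≤ φ x) →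
      gagliardoForm s w φ ≤ F * ∫ x, φ x) (hF : 0 ≤ F)
    (hq : IsTestFunction U q) (hq0 : ∀ x, 0 ≤ q x) (hq1 : ∀ x, q x ≤ 1) (hk : 0 ≤ k)
    {B : Set (EuclideanSpace ℝ (Fin N))} (hB : MeasurableSet B) (hBv : volume B < ⊤)
    (hqB : ∀ x, x ∉ B → q x = 0) (hwB : ∫⁻ x in B, ENNReal.ofReal (w x ^ 2) < ⊤) :
    Integrable (fun p : EuclideanSpace ℝ (Fin N) × EuclideanSpace ℝ (Fin N) =>
      (w p.1 - w p.2) * (q p.1 * max 0 (w p.1 - k) - q p.2 * max 0 (w p.2 - k))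
        * fracKernel s p.1 p.2) ∧
    Integrable (fun x => q x * max 0 (w x - k)) ∧
    gagliardoForm s w (fun x => q x * max 0 (w x - k)) ≤ F * ∫ x, q x * max 0 (w x - k) := by
  have hwE := gagliardoEnergy_lt_top_of_memHomogeneousSobolev hN hs0 hs1 hw
  obtain ⟨A, hAt, hA⟩ := hq.exists_lintegral_sq_sub_le hN hs0 hs1
  have hK := measurable_fracKernel (N := N) (s := s)
  have hK0 : ∀ p : EuclideanSpace ℝ (Fin N) × EuclideanSpace ℝ (Fin N),
    0 ≤ fracKernel s p.1 p.2 := fun p => fracKernel_nonneg _ _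
  have hqm := hq.measurable
  -- On `B`, which contains the points where `q` is nonzero, `b` majorizes every truncation of `w -
  -- k` uniformly in `M`, and it is square integrable.
  set b : EuclideanSpace ℝ (Fin N) → ℝ := B.indicator (fun x => |w x|) with hb
  have hbm : Measurable b := Measurable.indicator (by fun_prop) hB
  have hb0 : ∀ x, 0 ≤ b x := fun x => Set.indicator_nonneg (fun _ _ => abs_nonneg _) x
  have hbsq : ∫⁻ x, ENNReal.ofReal (b x ^ 2) < ⊤ := by
    refine lt_of_eq_of_lt ?_ hwB
    rw [← lintegral_indicator hB]
    refine lintegral_congr fun x => ?_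
    by_cases hx : x ∈ B <;> simp [hb, hx]
  have hbi : Integrable b := by
    have h1 : Integrable (B.indicator (1 : EuclideanSpace ℝ (Fin N) → ℝ)) :=
      (integrable_indicator_iff hB).2 (integrableOn_const hBv.ne)
    have h2 : Integrable fun x => b x ^ 2 := by
      refine ⟨by fun_prop, ?_⟩
      rwa [hasFiniteIntegral_iff_ofReal (Eventually.of_forall fun x => sq_nonneg _)]
    refine (h1.add h2).mono' (by fun_prop) (Eventually.of_forall fun x => ?_)
    rw [Real.norm_of_nonneg (hb0 x), Pi.add_apply]
    by_cases hx : x ∈ B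
    · simp only [Set.indicator_of_mem hx, Pi.one_apply]
      nlinarith [sq_nonneg (b x - 1), hb0 x]
    · simp [hb, hx]
  have hpos : ∀ x, max 0 (w x - k) ≤ |w x| := fun x =>
    max_le (abs_nonneg _) (by linarith [le_abs_self (w x)])
  have hqb : ∀ x, q x * max 0 (w x - k) ≤ b x := fun x => by
    by_cases hx : x ∈ B
    · simp only [hb, Set.indicator_of_mem hx]
      exact (mul_le_of_le_one_left (le_max_left _ _) (hq1 x)).trans (hpos x)
    · simp [hb, hx, hqB x hx]
  have hψi : Integrable (fun x => q x * max 0 (w x - k)) := by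
    refine hbi.mono' (by fun_prop) (Eventually.of_forall fun x => ?_)
    rw [Real.norm_of_nonneg (mul_nonneg (hq0 x) (le_max_left _ _))]
    exact hqb x
  have hwi := integrable_sq_sub_mul_fracKernel hwm hwE
  have hb1 : Integrable fun p : EuclideanSpace ℝ (Fin N) × EuclideanSpace ℝ (Fin N) =>
      (b p.1 * (q p.1 - q p.2)) ^ 2 * fracKernel s p.1 p.2 := by
    refine ⟨by fun_prop, ?_⟩
    rw [hasFiniteIntegral_iff_ofReal (Eventually.of_forall fun p =>
      mul_nonneg (sq_nonneg _) (hK0 p))]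
    refine lt_of_le_of_lt ?_ (ENNReal.mul_lt_top hbsq hAt)
    refine le_trans (le_of_eq (lintegral_congr fun p => ?_))
      (lintegral_fst_mul_sq_sub_mul_fracKernel_le (by fun_prop) hqm hA)
    rw [← ENNReal.ofReal_mul (sq_nonneg _), mul_pow, mul_assoc]
  have hb2 : Integrable fun p : EuclideanSpace ℝ (Fin N) × EuclideanSpace ℝ (Fin N) =>
      (b p.2 * (q p.1 - q p.2)) ^ 2 * fracKernel s p.1 p.2 := by
    refine ⟨by fun_prop, ?_⟩
    rw [hasFiniteIntegral_iff_ofReal (Eventually.of_forall fun p =>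
      mul_nonneg (sq_nonneg _) (hK0 p))]
    refine lt_of_le_of_lt ?_ (ENNReal.mul_lt_top hbsq hAt)
    refine le_trans (le_of_eq (lintegral_congr fun p => ?_))
      (lintegral_snd_mul_sq_sub_mul_fracKernel_le (by fun_prop) hqm hA)
    rw [← ENNReal.ofReal_mul (sq_nonneg _), mul_pow, mul_assoc]
  set G : EuclideanSpace ℝ (Fin N) × EuclideanSpace ℝ (Fin N) → ℝ := fun p =>
    (w p.1 - w p.2) ^ 2 * fracKernel s p.1 p.2
      + |w p.1 - w p.2| * |b p.1 * (q p.1 - q p.2)| * fracKernel s p.1 p.2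
      + |w p.1 - w p.2| * |b p.2 * (q p.1 - q p.2)| * fracKernel s p.1 p.2 with hG
  have hGi : Integrable G := (hwi.add (integrable_abs_mul_abs_mul (by fun_prop) (by fun_prop)
    hK hK0 hwi hb1)).add (integrable_abs_mul_abs_mul (by fun_prop) (by fun_prop) hK hK0 hwi hb2)
  have hdom : ∀ (M : ℝ) (p : EuclideanSpace ℝ (Fin N) × EuclideanSpace ℝ (Fin N)),
      ‖(w p.1 - w p.2) * (q p.1 * max 0 (min (w p.1 - k) M) - q p.2 * max 0 (min (w p.2 - k) M))
        * fracKernel s p.1 p.2‖ ≤ G p := by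
    intro M p
    have hKp := hK0 p
    have hv : ∀ x, max 0 (min (w x - k) M) ≤ |w x| := fun x =>
      (max_le_max le_rfl (min_le_left _ _)).trans (hpos x)
    have h1 : |q p.1 * max 0 (min (w p.1 - k) M) - q p.2 * max 0 (min (w p.2 - k) M)|
        ≤ |w p.1 - w p.2| + |b p.1 * (q p.1 - q p.2)| + |b p.2 * (q p.1 - q p.2)| := by
      rw [abs_mul (b p.1), abs_mul (b p.2), abs_of_nonneg (hb0 p.1), abs_of_nonneg (hb0 p.2)]
      have n1 := mul_nonneg (hb0 p.1) (abs_nonneg (q p.1 - q p.2))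
      have n2 := mul_nonneg (hb0 p.2) (abs_nonneg (q p.1 - q p.2))
      by_cases h2 : p.2 ∈ B
      · have h3 := abs_mul_sub_mul_le (b := q p.2) (c := max 0 (min (w p.1 - k) M))
          (d := max 0 (min (w p.2 - k) M)) (hq0 p.1) (hq1 p.1) (le_max_left _ _)
        have h4 := abs_trunc_sub_le k M (w p.1) (w p.2)
        have h5 : max 0 (min (w p.2 - k) M) * |q p.1 - q p.2| ≤ b p.2 * |q p.1 - q p.2| := by
          gcongr
          simpa [hb, h2] using hv p.2
        linarith
      -- Here `q p.2 = 0`, so the surviving term `q p.1` is itself the increment of `q`, and it is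
      -- weighted by `b p.1`.
      · rw [hqB _ h2] at n1 n2 ⊢
        have h6 : q p.1 * max 0 (min (w p.1 - k) M) ≤ b p.1 * |q p.1 - 0| := by
          rw [sub_zero, abs_of_nonneg (hq0 _)]
          by_cases h1 : p.1 ∈ B
          · rw [mul_comm]
            gcongr
            · exact hq0 _
            · simpa [hb, h1] using hv p.1
          · simp [hqB _ h1]
        rw [zero_mul, sub_zero, abs_of_nonneg (mul_nonneg (hq0 _) (le_max_left _ _))]
        linarith [abs_nonneg (w p.1 - w p.2)]
    rw [Real.norm_eq_abs, abs_mul, abs_mul, abs_of_nonneg hKp]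
    calc _ ≤ |w p.1 - w p.2| * (|w p.1 - w p.2| + |b p.1 * (q p.1 - q p.2)|
          + |b p.2 * (q p.1 - q p.2)|) * fracKernel s p.1 p.2 := by gcongr
      _ = G p := by
        simp only [hG]
        rw [← sq_abs (w p.1 - w p.2)]
        ring
  have hev : ∀ x, ∀ᶠ n : ℕ in atTop, max 0 (min (w x - k) (n : ℝ)) = max 0 (w x - k) := by
    intro x
    obtain ⟨n₀, hn₀⟩ := exists_nat_ge (w x - k)
    filter_upwards [eventually_ge_atTop n₀] with n hn
    rw [min_eq_left (hn₀.trans (by exact_mod_cast hn))]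
  have hlim : ∀ x, Tendsto (fun n : ℕ => q x * max 0 (min (w x - k) (n : ℝ))) atTop
      (𝓝 (q x * max 0 (w x - k))) := fun x =>
    (tendsto_const_nhds.congr' ((hev x).mono fun n hn => hn.symm)).const_mul _
  have hmeas : ∀ n : ℕ, AEStronglyMeasurable
      (fun p : EuclideanSpace ℝ (Fin N) × EuclideanSpace ℝ (Fin N) =>
      (w p.1 - w p.2) * (q p.1 * max 0 (min (w p.1 - k) n) - q p.2 * max 0 (min (w p.2 - k) n))
        * fracKernel s p.1 p.2) := fun n => Measurable.aestronglyMeasurable (by fun_prop)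
  have hptlim : ∀ p : EuclideanSpace ℝ (Fin N) × EuclideanSpace ℝ (Fin N),
      Tendsto (fun n : ℕ => (w p.1 - w p.2) * (q p.1 * max 0 (min (w p.1 - k) n)
        - q p.2 * max 0 (min (w p.2 - k) n)) * fracKernel s p.1 p.2) atTop
      (𝓝 ((w p.1 - w p.2) * (q p.1 * max 0 (w p.1 - k) - q p.2 * max 0 (w p.2 - k))
        * fracKernel s p.1 p.2)) := fun p =>
    (((hlim p.1).sub (hlim p.2)).const_mul _).mul_const _
  refine ⟨hGi.mono' (by fun_prop) (Eventually.of_forall fun p => ?_), hψi, ?_⟩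
  · exact le_of_tendsto' (hptlim p).norm fun n => hdom n p
  · refine le_of_tendsto (tendsto_integral_of_dominated_convergence G hmeas hGi
      (fun n => Eventually.of_forall fun p => hdom n p) (Eventually.of_forall hptlim))
      (Eventually.of_forall fun n : ℕ => ?_)
    refine (gagliardoForm_mul_truncation_le hN hs0 hs1 hwm hw hsub hq hq0 hq1
      (Nat.cast_nonneg n)).trans ?_
    refine mul_le_mul_of_nonneg_left (integral_mono_of_nonneg (Eventually.of_forall fun x =>
      mul_nonneg (hq0 x) (le_max_left _ _)) hψi (Eventually.of_forall fun x => ?_)) hF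
    exact mul_le_mul_of_nonneg_left (max_le_max le_rfl (min_le_left _ _)) (hq0 x)

/-- The algebraic inequality behind the Caccioppoli estimate. -/
theorem sq_sub_le_mul_add (a b k c d : ℝ) :
    (c * max 0 (a - k) - d * max 0 (b - k)) ^ 2
      ≤ (a - b) * (c ^ 2 * max 0 (a - k) - d ^ 2 * max 0 (b - k))
        + max 0 (a - k) * max 0 (b - k) * (c - d) ^ 2 := by
  -- When both values exceed `k` this is an identity. When only one does, the remainder vanishes and
  -- `|a - b|` is at least the positive part that survives.
  rcases le_total (a - k) 0 with ha | ha <;> rcases le_total (b - k) 0 with hb | hb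
  · rw [max_eq_left ha, max_eq_left hb]
    simp
  · rw [max_eq_left ha, max_eq_right hb]
    nlinarith [mul_nonneg (mul_nonneg (sq_nonneg d) hb) (neg_nonneg.2 ha)]
  · rw [max_eq_right ha, max_eq_left hb]
    nlinarith [mul_nonneg (mul_nonneg (sq_nonneg c) ha) (neg_nonneg.2 hb)]
  · rw [max_eq_right ha, max_eq_right hb]
    apply le_of_eq
    ring

variable {η : EuclideanSpace ℝ (Fin N) → ℝ}

/-- The cutoff is squared in the test function, so that `sq_sub_le_mul_add` turns the form into the
energy of `η (w - k)₊` up to the cross term. -/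
theorem gagliardoEnergy_mul_posPart_le (hN : 1 ≤ N) (hs0 : 0 < s) (hs1 : s < 1)
    (hwm : Measurable w) (hw : MemHomogeneousSobolev s w)
    (hsub : ∀ φ : EuclideanSpace ℝ (Fin N) → ℝ, IsTestFunction U φ → (∀ x, 0 ≤ φ x) →
      gagliardoForm s w φ ≤ F * ∫ x, φ x) (hF : 0 ≤ F)
    (hη : IsTestFunction U η) (hη0 : ∀ x, 0 ≤ η x) (hη1 : ∀ x, η x ≤ 1) (hk : 0 ≤ k)
    {B : Set (EuclideanSpace ℝ (Fin N))} (hB : MeasurableSet B) (hBv : volume B < ⊤)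
    (hηB : ∀ x, x ∉ B → η x = 0) (hwB : ∫⁻ x in B, ENNReal.ofReal (w x ^ 2) < ⊤) :
    gagliardoEnergy s (fun x => η x * max 0 (w x - k))
      ≤ ENNReal.ofReal F * (∫⁻ x, ENNReal.ofReal (η x ^ 2 * max 0 (w x - k)))
        + ∫⁻ p : EuclideanSpace ℝ (Fin N) × EuclideanSpace ℝ (Fin N),
          ENNReal.ofReal (max 0 (w p.1 - k) * max 0 (w p.2 - k) * (η p.1 - η p.2) ^ 2
            * fracKernel s p.1 p.2) := by
  have hq : IsTestFunction U (fun x => η x ^ 2) := by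
    refine ⟨hη.1.pow 2, ?_, ?_⟩
    · exact hη.2.1.comp_left (g := fun t : ℝ => t ^ 2) (by simp)
    · have h := hη.2.2
      rwa [tsupport, ← Function.support_pow η two_ne_zero] at h
  obtain ⟨h1, h2, h3⟩ := gagliardoForm_mul_posPart_le hN hs0 hs1 hwm hw hsub hF hq
    (fun x => sq_nonneg _) (fun x => pow_le_one₀ (hη0 x) (hη1 x)) hk hB hBv
    (fun x hx => by simp [hηB x hx]) hwB
  have hK := measurable_fracKernel (N := N) (s := s)
  have hηm := hη.measurable
  set R : EuclideanSpace ℝ (Fin N) × EuclideanSpace ℝ (Fin N) → ℝ := fun p =>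
    max 0 (w p.1 - k) * max 0 (w p.2 - k) * (η p.1 - η p.2) ^ 2 * fracKernel s p.1 p.2 with hR
  have hR0 : ∀ p, 0 ≤ R p := fun p => by
    have := fracKernel_nonneg (s := s) p.1 p.2
    positivity
  -- An infinite cross term makes the bound trivial; a finite one makes `R` integrable, so real
  -- integrals may be added.
  rcases eq_or_ne (∫⁻ p, ENNReal.ofReal (R p)) ⊤ with htop | htop
  · rw [htop, add_top]
    exact le_top
  have hRi : Integrable R := by
    refine ⟨Measurable.aestronglyMeasurable (by fun_prop), ?_⟩
    rw [hasFiniteIntegral_iff_ofReal (Eventually.of_forall hR0)]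
    exact htop.lt_top
  set H : EuclideanSpace ℝ (Fin N) × EuclideanSpace ℝ (Fin N) → ℝ := fun p =>
      (w p.1 - w p.2) * (η p.1 ^ 2 * max 0 (w p.1 - k) - η p.2 ^ 2 * max 0 (w p.2 - k))
        * fracKernel s p.1 p.2 with hH
  have hle : ∀ p : EuclideanSpace ℝ (Fin N) × EuclideanSpace ℝ (Fin N),
      (η p.1 * max 0 (w p.1 - k) - η p.2 * max 0 (w p.2 - k)) ^ 2 * fracKernel s p.1 p.2
        ≤ (H + R) p := fun p => by
    rw [Pi.add_apply, hH, hR, ← add_mul]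
    exact mul_le_mul_of_nonneg_right (sq_sub_le_mul_add _ _ _ _ _) (fracKernel_nonneg _ _)
  calc gagliardoEnergy s (fun x => η x * max 0 (w x - k))
      ≤ ∫⁻ p, ENNReal.ofReal ((H + R) p) :=
        lintegral_mono fun p => ENNReal.ofReal_le_ofReal (hle p)
    _ = ENNReal.ofReal ((∫ p, H p) + ∫ p, R p) := by
        rw [← integral_add h1 hRi, ← ofReal_integral_eq_lintegral_ofReal (h1.add hRi)]
        · rfl
        · exact Eventually.of_forall fun p =>
            (mul_nonneg (sq_nonneg _) (fracKernel_nonneg _ _)).trans (hle p)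
    _ ≤ ENNReal.ofReal (F * (∫ x, η x ^ 2 * max 0 (w x - k)) + ∫ p, R p) := by
        refine ENNReal.ofReal_le_ofReal (add_le_add ?_ le_rfl)
        exact h3
    _ = _ := by
        have h0 : ∀ x, 0 ≤ η x ^ 2 * max 0 (w x - k) := fun x => by positivity
        rw [ENNReal.ofReal_add (mul_nonneg hF (integral_nonneg h0)) (integral_nonneg hR0),
          ENNReal.ofReal_mul hF,
          ofReal_integral_eq_lintegral_ofReal h2 (Eventually.of_forall h0),
          ofReal_integral_eq_lintegral_ofReal hRi (Eventually.of_forall hR0)]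

end Testing

/-! ### Smooth cutoffs between concentric balls with a quantitative Lipschitz constant. -/

section Cutoff

/-- The transition is constant outside `[0, 1]` and agrees on `[0, 1]` with a smooth compactly
supported bump, which is Lipschitz; projecting onto `[0, 1]` first loses nothing. -/
theorem exists_lipschitzWith_smoothTransition :
    ∃ L : NNReal, LipschitzWith L Real.smoothTransition := by
  set f : ℝ → ℝ := fun t => Real.smoothTransition t * Real.smoothTransition (2 - t) with hf
  have hfc : ContDiff ℝ ∞ f :=
    Real.smoothTransition.contDiff.mul
      (Real.smoothTransition.contDiff.comp (contDiff_const.sub contDiff_id))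
  have hfs : HasCompactSupport f := by
    refine HasCompactSupport.intro (isCompact_Icc (a := (0 : ℝ)) (b := 2)) fun t ht => ?_
    rcases lt_or_ge t 0 with h | h
    · simp [hf, Real.smoothTransition.zero_of_nonpos h.le]
    · have h2 : 2 < t := not_le.1 fun h2 => ht ⟨h, h2⟩
      simp [hf, Real.smoothTransition.zero_of_nonpos (show 2 - t ≤ 0 by linarith)]
  obtain ⟨L, hL⟩ := ContDiff.lipschitzWith_of_hasCompactSupport hfs hfc (by simp)
  refine ⟨L, ?_⟩
  have heq : Real.smoothTransition
      = f ∘ fun t => (Set.projIcc (0 : ℝ) 1 zero_le_one t : ℝ) := by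
    funext t
    have h1 : ((Set.projIcc (0 : ℝ) 1 zero_le_one t : Set.Icc (0 : ℝ) 1) : ℝ) ≤ 1 :=
      (Set.projIcc (0 : ℝ) 1 zero_le_one t).2.2
    simp only [hf, Function.comp_apply]
    rw [Real.smoothTransition.one_of_one_le (show 1 ≤ 2 -
      ((Set.projIcc (0 : ℝ) 1 zero_le_one t : Set.Icc (0 : ℝ) 1) : ℝ) by linarith), mul_one,
      Real.smoothTransition.projIcc]
  rw [heq]
  have h := hL.comp ((LipschitzWith.subtype_val _).comp
    (LipschitzWith.projIcc (zero_le_one (α := ℝ))))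
  simpa [Function.comp_def] using h

theorem abs_max_zero_sq_sub_le {a b R : ℝ} (ha : 0 ≤ a) (hb : 0 ≤ b) (hR : 0 ≤ R) :
    |max 0 (R ^ 2 - a ^ 2) - max 0 (R ^ 2 - b ^ 2)| ≤ 2 * R * |a - b| := by
  have key : ∀ a b : ℝ, 0 ≤ a → 0 ≤ b →
      max 0 (R ^ 2 - a ^ 2) - max 0 (R ^ 2 - b ^ 2) ≤ 2 * R * |a - b| := by
    intro a b ha hb
    have hn : 0 ≤ 2 * R * |a - b| := by positivity
    have habs : b - a ≤ |a - b| := by rw [abs_sub_comm]; exact le_abs_self _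
    rcases le_total R a with h | h
    · rw [max_eq_left (by nlinarith)]
      linarith [le_max_left 0 (R ^ 2 - b ^ 2)]
    · rw [max_eq_right (by nlinarith)]
      rcases le_total b R with h' | h'
      · have h1 : (b - a) * (b + a) ≤ |a - b| * (2 * R) :=
          mul_le_mul habs (by linarith) (by linarith) (abs_nonneg _)
        linarith [le_max_right 0 (R ^ 2 - b ^ 2)]
      · have h1 : (R - a) * (R + a) ≤ |a - b| * (2 * R) :=
          mul_le_mul (by linarith) (by linarith) (by linarith) (abs_nonneg _)
        linarith [le_max_left 0 (R ^ 2 - b ^ 2)]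
  have h1 := key a b ha hb
  have h2 := key b a hb ha
  rw [abs_sub_comm b a] at h2
  exact abs_le.2 ⟨by linarith, by linarith⟩

theorem exists_cutoff (N : ℕ) : ∃ L : ℝ, 0 ≤ L ∧ ∀ (x₀ : EuclideanSpace ℝ (Fin N)) (ρ R : ℝ),
    0 < ρ → ρ < R → ∃ η : EuclideanSpace ℝ (Fin N) → ℝ,
      IsTestFunction (closedBall x₀ R) η ∧ (∀ x, 0 ≤ η x) ∧ (∀ x, η x ≤ 1) ∧
      (∀ x ∈ ball x₀ ρ, η x = 1) ∧ (∀ x, x ∉ ball x₀ R → η x = 0) ∧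
      ∀ x y, |η x - η y| ≤ L / (R - ρ) * ‖x - y‖ := by
  obtain ⟨L, hL⟩ := exists_lipschitzWith_smoothTransition
  refine ⟨2 * L, by positivity, fun x₀ ρ R hρ hR => ?_⟩
  have hD : 0 < R ^ 2 - ρ ^ 2 := by nlinarith
  -- The squared norm keeps `η` smooth at the centre.
  set η : EuclideanSpace ℝ (Fin N) → ℝ :=
    fun x => Real.smoothTransition ((R ^ 2 - ‖x - x₀‖ ^ 2) / (R ^ 2 - ρ ^ 2)) with hη
  have hη0 : ∀ x, x ∉ ball x₀ R → η x = 0 := fun x hx => by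
    rw [mem_ball, dist_eq_norm, not_lt] at hx
    refine Real.smoothTransition.zero_of_nonpos (div_nonpos_of_nonpos_of_nonneg ?_ hD.le)
    nlinarith
  have hts : tsupport η ⊆ closedBall x₀ R := by
    refine closure_minimal (fun x hx => ?_) isClosed_closedBall
    by_contra h
    exact hx (hη0 x fun h' => h (ball_subset_closedBall h'))
  refine ⟨η, ⟨?_, ?_, hts⟩, fun x => Real.smoothTransition.nonneg _,
    fun x => Real.smoothTransition.le_one _, fun x hx => ?_, hη0, fun x y => ?_⟩
  · refine Real.smoothTransition.contDiff.comp (ContDiff.div_const (contDiff_const.sub ?_) _)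
    exact (contDiff_id.sub contDiff_const).norm_sq ℝ
  · exact (isCompact_closedBall x₀ R).of_isClosed_subset (isClosed_tsupport η) hts
  · rw [mem_ball, dist_eq_norm] at hx
    refine Real.smoothTransition.one_of_one_le ((one_le_div hD).2 ?_)
    nlinarith [norm_nonneg (x - x₀)]
  -- The squared norm is not globally Lipschitz, but the transition ignores negative arguments, and
  -- the positive part of `R² - ‖x - x₀‖²` is `2R`-Lipschitz.
  · have hmax : ∀ t : ℝ, Real.smoothTransition (max 0 t) = Real.smoothTransition t := fun t => by
      rcases le_total t 0 with h | h
      · rw [max_eq_left h, Real.smoothTransition.zero, Real.smoothTransition.zero_of_nonpos h]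
      · rw [max_eq_right h]
    have hdiv : ∀ t : ℝ, max 0 (t / (R ^ 2 - ρ ^ 2)) = max 0 t / (R ^ 2 - ρ ^ 2) := fun t => by
      rw [← max_div_div_right hD.le, zero_div]
    have h1 := hL.dist_le_mul (max 0 ((R ^ 2 - ‖x - x₀‖ ^ 2) / (R ^ 2 - ρ ^ 2)))
      (max 0 ((R ^ 2 - ‖y - x₀‖ ^ 2) / (R ^ 2 - ρ ^ 2)))
    rw [hmax, hmax, Real.dist_eq, Real.dist_eq, hdiv, hdiv, ← sub_div, abs_div,
      abs_of_pos hD] at h1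
    have h2 := abs_max_zero_sq_sub_le (norm_nonneg (x - x₀)) (norm_nonneg (y - x₀))
      (hρ.trans hR).le
    have h3 : |‖x - x₀‖ - ‖y - x₀‖| ≤ ‖x - y‖ := by
      simpa using abs_norm_sub_norm_le (x - x₀) (y - x₀)
    have hRρ : 0 < R - ρ := sub_pos.2 hR
    calc |η x - η y| ≤ L * (|max 0 (R ^ 2 - ‖x - x₀‖ ^ 2) - max 0 (R ^ 2 - ‖y - x₀‖ ^ 2)|
          / (R ^ 2 - ρ ^ 2)) := h1
      _ ≤ L * ((2 * R * ‖x - y‖) / (R ^ 2 - ρ ^ 2)) := by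
          have : 0 < R := hρ.trans hR
          gcongr
          exact h2.trans (by gcongr)
      _ = 2 * L * (R / (R + ρ)) / (R - ρ) * ‖x - y‖ := by
          rw [show R ^ 2 - ρ ^ 2 = (R + ρ) * (R - ρ) by ring]
          have : R + ρ ≠ 0 := by linarith
          field_simp
      _ ≤ 2 * L * 1 / (R - ρ) * ‖x - y‖ := by
          gcongr
          exact (div_le_one (by linarith)).2 (by linarith)
      _ = _ := by rw [mul_one]

end Cutoff

/-! ### Energy lower bound for functions supported on small sets. -/

section FaberKrahn

variable {N : ℕ} {s : ℝ}

/-- Half of the volume of the unit ball. -/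
noncomputable def halfUnitBallVolume (N : ℕ) : ℝ :=
  (volume (ball (0 : EuclideanSpace ℝ (Fin N)) 1)).toReal / 2

theorem halfUnitBallVolume_pos (N : ℕ) : 0 < halfUnitBallVolume N :=
  half_pos (ENNReal.toReal_pos (measure_ball_pos _ _ one_pos).ne' measure_ball_lt_top.ne)

theorem volume_ball_eq_halfUnitBallVolume (x : EuclideanSpace ℝ (Fin N)) {ρ : ℝ} (hρ : 0 < ρ) :
    volume (ball x ρ) = ENNReal.ofReal (2 * (halfUnitBallVolume N * ρ ^ N)) := by
  rw [Measure.addHaar_ball_of_pos _ _ hρ, finrank_euclideanSpace_fin,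
    ← ENNReal.ofReal_toReal (measure_ball_lt_top (μ := volume)
      (x := (0 : EuclideanSpace ℝ (Fin N))) (r := 1)).ne,
    ← ENNReal.ofReal_mul (by positivity), halfUnitBallVolume]
  congr 1
  ring

/-- A fractional Faber-Krahn inequality. -/
theorem lintegral_sq_le_gagliardoEnergy {u : EuclideanSpace ℝ (Fin N) → ℝ} (hu : Measurable u)
    (hs0 : 0 < s) {S : Set (EuclideanSpace ℝ (Fin N))} (hS : MeasurableSet S)
    (huS : ∀ x, x ∉ S → u x = 0)
    {ρ : ℝ} (hρ : 0 < ρ) (hv : volume S ≤ ENNReal.ofReal (halfUnitBallVolume N * ρ ^ N)) :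
    ENNReal.ofReal (halfUnitBallVolume N * ρ ^ (-(2 * s))) * ∫⁻ x, ENNReal.ofReal (u x ^ 2)
      ≤ gagliardoEnergy s u := by
  have hK := measurable_fracKernel (N := N) (s := s)
  have hκ := halfUnitBallVolume_pos N
  unfold gagliardoEnergy
  rw [Measure.volume_eq_prod, lintegral_prod _ (by fun_prop),
    ← lintegral_const_mul' _ _ ENNReal.ofReal_ne_top]
  refine lintegral_mono fun x => ?_
  by_cases hx : x ∈ S
  swap
  · simp [huS x hx]
  -- The support `S` fills at most half of `ball x ρ`; on the other half `u` vanishes while the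
  -- kernel is at least `ρ ^ (-(N + 2s))`.
  have hvol : ENNReal.ofReal (halfUnitBallVolume N * ρ ^ N) ≤ volume (ball x ρ \ S) := by
    refine le_trans ?_ (le_measure_sdiff (μ := volume) (s₁ := ball x ρ) (s₂ := S))
    rw [volume_ball_eq_halfUnitBallVolume x hρ]
    refine le_trans ?_ (tsub_le_tsub_left hv _)
    rw [← ENNReal.ofReal_sub _ (by positivity)]
    exact ENNReal.ofReal_le_ofReal (by linarith)
  calc ENNReal.ofReal (halfUnitBallVolume N * ρ ^ (-(2 * s))) * ENNReal.ofReal (u x ^ 2)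
      = ENNReal.ofReal (u x ^ 2 * (ρ ^ ((N : ℝ) + 2 * s))⁻¹)
        * ENNReal.ofReal (halfUnitBallVolume N * ρ ^ N) := by
        rw [← ENNReal.ofReal_mul (by positivity), ← ENNReal.ofReal_mul (by positivity),
          Real.rpow_add hρ, Real.rpow_natCast, Real.rpow_neg hρ.le]
        congr 1
        field_simp
    _ ≤ ENNReal.ofReal (u x ^ 2 * (ρ ^ ((N : ℝ) + 2 * s))⁻¹) * volume (ball x ρ \ S) := by
        gcongr
    _ = ∫⁻ _ in ball x ρ \ S, ENNReal.ofReal (u x ^ 2 * (ρ ^ ((N : ℝ) + 2 * s))⁻¹) := by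
        rw [setLIntegral_const]
    _ ≤ ∫⁻ y in ball x ρ \ S, ENNReal.ofReal ((u x - u y) ^ 2 * fracKernel s x y) := by
        refine setLIntegral_mono' (measurableSet_ball.diff hS) fun y hy => ?_
        have hxy : 0 < ‖x - y‖ := norm_pos_iff.2 (sub_ne_zero.2 fun h => hy.2 (h ▸ hx))
        have hyρ : ‖x - y‖ ≤ ρ := by
          have := hy.1
          rw [mem_ball, dist_comm, dist_eq_norm] at this
          exact this.le
        rw [huS y hy.2, sub_zero]
        unfold fracKernel
        gcongr
    _ ≤ _ := setLIntegral_le_lintegral _ _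

end FaberKrahn

/-! ### The nonlocal cross term. -/

section Caccioppoli

variable {N : ℕ} {s : ℝ}

/-- For two points in the ball, `v(x) v(y) ≤ v(x)² + v(y)²` and the energy density of `η` suffice.
If one point lies outside, `η` vanishes there, and the other may be taken in the smaller ball, away
from the boundary; `hcR` then replaces it by `x₀` in the kernel, which produces the tail. -/
theorem lintegral_mul_mul_sq_sub_mul_fracKernel_le (hs0 : 0 < s)
    {w v η : EuclideanSpace ℝ (Fin N) → ℝ} (hwm : Measurable w) (hvm : Measurable v)
    (hηm : Measurable η) (hη0 : ∀ x, 0 ≤ η x) (hη1 : ∀ x, η x ≤ 1)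
    (hv0 : ∀ x, 0 ≤ v x) (hvw : ∀ x, v x ≤ |w x|)
    {x₀ : EuclideanSpace ℝ (Fin N)} {R' R c : ℝ} (hRR : R' ≤ R) (hR : 0 < R) (hc : 0 < c)
    (hηR : ∀ x, x ∉ ball x₀ R' → η x = 0)
    (hcR : ∀ x ∈ ball x₀ R', ∀ y, y ∉ ball x₀ R → ‖x₀ - y‖ ≤ c * ‖x - y‖) {A : ℝ≥0∞}
    (hA : ∀ x, ∫⁻ y, ENNReal.ofReal ((η x - η y) ^ 2 * fracKernel s x y) ≤ A) :
    ∫⁻ p : EuclideanSpace ℝ (Fin N) × EuclideanSpace ℝ (Fin N),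
        ENNReal.ofReal (v p.1 * v p.2 * (η p.1 - η p.2) ^ 2
          * fracKernel s p.1 p.2)
      ≤ 2 * ((∫⁻ x in ball x₀ R, ENNReal.ofReal (v x ^ 2)) * A)
        + 2 * ((∫⁻ x in ball x₀ R, ENNReal.ofReal (v x))
          * (ENNReal.ofReal (c ^ ((N : ℝ) + 2 * s))
            * ∫⁻ x in (ball x₀ R)ᶜ, ENNReal.ofReal (|w x| * fracKernel s x x₀))) := by
  have hK := measurable_fracKernel (N := N) (s := s)
  have hKx : Measurable fun y : EuclideanSpace ℝ (Fin N) => fracKernel s y x₀ := by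
    unfold fracKernel
    fun_prop
  set B := ball x₀ R with hB
  have hBm : MeasurableSet B := measurableSet_ball
  set a : EuclideanSpace ℝ (Fin N) → ℝ≥0∞ := B.indicator fun x => ENNReal.ofReal (v x ^ 2)
    with ha
  set b : EuclideanSpace ℝ (Fin N) → ℝ≥0∞ := B.indicator fun x => ENNReal.ofReal (v x) with hb
  set t : EuclideanSpace ℝ (Fin N) → ℝ≥0∞ := Bᶜ.indicator fun x =>
    ENNReal.ofReal (c ^ ((N : ℝ) + 2 * s)) * ENNReal.ofReal (|w x| * fracKernel s x x₀) with ht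
  have ham : Measurable a := Measurable.indicator (by fun_prop) hBm
  have hbm : Measurable b := Measurable.indicator (by fun_prop) hBm
  have htm : Measurable t := Measurable.indicator (by fun_prop) hBm.compl
  have hout : ∀ x, x ∉ B → η x = 0 := fun x hx =>
    hηR x fun h => hx (ball_subset_ball hRR h)
  have hmixed : ∀ x y, x ∈ B → y ∉ B →
      ENNReal.ofReal (v x * v y * (η x) ^ 2 * fracKernel s x y) ≤ b x * t y := by
    intro x y hx hy
    by_cases hxR : x ∈ ball x₀ R'
    swap
    · simp [hηR x hxR]
    have hy' : y ∈ Bᶜ := hy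
    have hx₀y : x₀ ≠ y := fun h => hy (h ▸ mem_ball_self hR)
    simp only [hb, ht, Set.indicator_of_mem hx, Set.indicator_of_mem hy']
    rw [← ENNReal.ofReal_mul (by positivity), ← ENNReal.ofReal_mul (hv0 x)]
    refine ENNReal.ofReal_le_ofReal ?_
    have h1 := fracKernel_le_of_norm_sub_le hs0 hc hx₀y (hcR x hxR y hy)
    rw [fracKernel_comm x₀ y] at h1
    have h2 : η x ^ 2 ≤ 1 := pow_le_one₀ (hη0 x) (hη1 x)
    have h3 := fracKernel_nonneg (s := s) x y
    calc v x * v y * η x ^ 2 * fracKernel s x y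
        ≤ v x * |w y| * 1 * (c ^ ((N : ℝ) + 2 * s) * fracKernel s y x₀) := by
          have := hv0 x
          gcongr
          exact hvw y
      _ = _ := by ring
  have hpt : ∀ p : EuclideanSpace ℝ (Fin N) × EuclideanSpace ℝ (Fin N),
      ENNReal.ofReal (v p.1 * v p.2 * (η p.1 - η p.2) ^ 2 * fracKernel s p.1 p.2)
        ≤ (a p.1 * ENNReal.ofReal ((η p.1 - η p.2) ^ 2 * fracKernel s p.1 p.2)
          + a p.2 * ENNReal.ofReal ((η p.1 - η p.2) ^ 2 * fracKernel s p.1 p.2))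
          + (b p.1 * t p.2 + t p.1 * b p.2) := by
    intro p
    have hKp := fracKernel_nonneg (s := s) p.1 p.2
    by_cases h1 : p.1 ∈ B <;> by_cases h2 : p.2 ∈ B
    · refine le_trans ?_ le_self_add
      simp only [ha, Set.indicator_of_mem h1, Set.indicator_of_mem h2]
      rw [← add_mul, ← ENNReal.ofReal_add (sq_nonneg _) (sq_nonneg _),
        ← ENNReal.ofReal_mul (by positivity), mul_assoc (v p.1 * v p.2)]
      refine ENNReal.ofReal_le_ofReal (mul_le_mul_of_nonneg_right ?_ (by positivity))
      nlinarith [sq_nonneg (v p.1 - v p.2), sq_nonneg (v p.1), sq_nonneg (v p.2)]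
    · refine le_trans ?_ (le_trans le_self_add le_add_self)
      rw [hout _ h2, sub_zero]
      exact hmixed _ _ h1 h2
    · refine le_trans ?_ (le_trans le_add_self le_add_self)
      rw [hout _ h1, zero_sub, neg_sq, mul_comm (v p.1), fracKernel_comm, mul_comm (t p.1)]
      exact hmixed _ _ h2 h1
    · simp [hout _ h1, hout _ h2]
  have hai : ∫⁻ x, a x = ∫⁻ x in B, ENNReal.ofReal (v x ^ 2) := lintegral_indicator hBm _
  have hbi : ∫⁻ x, b x = ∫⁻ x in B, ENNReal.ofReal (v x) := lintegral_indicator hBm _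
  have hti : ∫⁻ x, t x = ENNReal.ofReal (c ^ ((N : ℝ) + 2 * s))
      * ∫⁻ x in Bᶜ, ENNReal.ofReal (|w x| * fracKernel s x x₀) := by
    rw [ht, lintegral_indicator hBm.compl, lintegral_const_mul' _ _ ENNReal.ofReal_ne_top]
  refine (lintegral_mono hpt).trans ?_
  rw [lintegral_add_left (by fun_prop), lintegral_add_left (by fun_prop),
    lintegral_add_left (by fun_prop), ← hai, ← hbi, ← hti, two_mul, two_mul]
  refine add_le_add (add_le_add (lintegral_fst_mul_sq_sub_mul_fracKernel_le ham hηm hA)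
    (lintegral_snd_mul_sq_sub_mul_fracKernel_le ham hηm hA)) (le_of_eq ?_)
  rw [Measure.volume_eq_prod, lintegral_prod_mul hbm.aemeasurable htm.aemeasurable,
    lintegral_prod_mul htm.aemeasurable hbm.aemeasurable, mul_comm (∫⁻ x, t x)]

end Caccioppoli

/-! ### The iteration over levels and radii. -/

section DeGiorgi

variable {N : ℕ} {s : ℝ}

/-- Above `k'` the excess over `k` is at least `k' - k`; this trades linear mass above `k'` for
quadratic mass above `k`. -/
theorem max_zero_sub_le_sq_div {a k k' : ℝ} (hk : k < k') :
    max 0 (a - k') ≤ max 0 (a - k) ^ 2 * (k' - k)⁻¹ := by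
  have h : 0 < k' - k := sub_pos.2 hk
  rcases le_total (a - k') 0 with ha | ha
  · rw [max_eq_left ha]
    positivity
  · rw [max_eq_right ha, max_eq_right (by linarith), ← div_eq_mul_inv, le_div_iff₀ h]
    nlinarith

/-- One step of the De Giorgi iteration. -/
theorem lintegral_posPart_sq_le_of_step (hN : 1 ≤ N) (hs0 : 0 < s) (hs1 : s < 1)
    {U : Set (EuclideanSpace ℝ (Fin N))} {w η : EuclideanSpace ℝ (Fin N) → ℝ} {F : ℝ}
    (hwm : Measurable w) (hw : MemHomogeneousSobolev s w)
    (hsub : ∀ φ : EuclideanSpace ℝ (Fin N) → ℝ, IsTestFunction U φ → (∀ x, 0 ≤ φ x) →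
      gagliardoForm s w φ ≤ F * ∫ x, φ x) (hF : 0 ≤ F)
    (hη : IsTestFunction U η) (hη0 : ∀ x, 0 ≤ η x) (hη1 : ∀ x, η x ≤ 1)
    {x₀ : EuclideanSpace ℝ (Fin N)} {ρ R' R c k k' A T a σ D : ℝ} (hRR : R' ≤ R) (hR : 0 < R)
    (hc : 0 < c) (hηR : ∀ x, x ∉ ball x₀ R' → η x = 0) (hηρ : ∀ x ∈ ball x₀ ρ, η x = 1)
    (hcR : ∀ x ∈ ball x₀ R', ∀ y, y ∉ ball x₀ R → ‖x₀ - y‖ ≤ c * ‖x - y‖)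
    (hA : ∀ x, ∫⁻ y, ENNReal.ofReal ((η x - η y) ^ 2 * fracKernel s x y) ≤ ENNReal.ofReal A)
    (hA0 : 0 ≤ A) (hT : 0 ≤ T)
    (htail : ∫⁻ x in (ball x₀ R)ᶜ, ENNReal.ofReal (|w x| * fracKernel s x x₀)
      ≤ ENNReal.ofReal T)
    (hwB : ∫⁻ x in ball x₀ R, ENNReal.ofReal (w x ^ 2) < ⊤) (hk : 0 ≤ k) (hkk : k < k')
    (ha : 0 ≤ a) (hY : ∫⁻ x in ball x₀ R, ENNReal.ofReal (max 0 (w x - k) ^ 2) ≤ ENNReal.ofReal a)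
    (hσ : 0 < σ) (hσa : a / (k' - k) ^ 2 ≤ halfUnitBallVolume N * σ ^ N)
    (hD : (F + 2 * c ^ ((N : ℝ) + 2 * s) * T) / (k' - k) + 2 * A ≤ D) :
    ∫⁻ x in ball x₀ ρ, ENNReal.ofReal (max 0 (w x - k') ^ 2)
      ≤ ENNReal.ofReal ((halfUnitBallVolume N)⁻¹ * σ ^ (2 * s) * D * a) := by
  have hκ := halfUnitBallVolume_pos N
  have hh : 0 < k' - k := sub_pos.2 hkk
  have hηm := hη.measurable
  have hout : ∀ x, x ∉ ball x₀ R → η x = 0 := fun x hx =>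
    hηR x fun h => hx (ball_subset_ball hRR h)
  have hv1 : ∫⁻ x in ball x₀ R, ENNReal.ofReal (max 0 (w x - k'))
      ≤ ENNReal.ofReal (a * (k' - k)⁻¹) := by
    calc _ ≤ ∫⁻ x in ball x₀ R, ENNReal.ofReal (max 0 (w x - k) ^ 2)
          * ENNReal.ofReal (k' - k)⁻¹ := by
          refine lintegral_mono fun x => ?_
          rw [← ENNReal.ofReal_mul (sq_nonneg _)]
          exact ENNReal.ofReal_le_ofReal (max_zero_sub_le_sq_div hkk)
      _ ≤ _ := by
          rw [lintegral_mul_const' _ _ ENNReal.ofReal_ne_top, ENNReal.ofReal_mul ha]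
          gcongr
  have hv2 : ∫⁻ x in ball x₀ R, ENNReal.ofReal (max 0 (w x - k') ^ 2) ≤ ENNReal.ofReal a := by
    refine le_trans (lintegral_mono fun x => ENNReal.ofReal_le_ofReal ?_) hY
    exact pow_le_pow_left₀ (le_max_left _ _) (max_le_max le_rfl (by linarith)) 2
  have hηv : ∫⁻ x, ENNReal.ofReal (η x ^ 2 * max 0 (w x - k'))
      ≤ ENNReal.ofReal (a * (k' - k)⁻¹) := by
    refine le_trans ?_ hv1
    rw [← lintegral_indicator measurableSet_ball]
    refine lintegral_mono fun x => ?_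
    by_cases hx : x ∈ ball x₀ R
    · rw [Set.indicator_of_mem hx]
      exact ENNReal.ofReal_le_ofReal (mul_le_of_le_one_left (le_max_left _ _)
        (pow_le_one₀ (hη0 x) (hη1 x)))
    · simp [hout x hx]
  have hE : gagliardoEnergy s (fun x => η x * max 0 (w x - k')) ≤ ENNReal.ofReal (D * a) := by
    have h1 := gagliardoEnergy_mul_posPart_le hN hs0 hs1 hwm hw hsub hF hη hη0 hη1
      (hk.trans hkk.le) measurableSet_ball measure_ball_lt_top hout hwB
    have h2 := lintegral_mul_mul_sq_sub_mul_fracKernel_le hs0 hwm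
      (v := fun x => max 0 (w x - k')) (by fun_prop) hηm hη0 hη1 (fun x => le_max_left _ _)
      (fun x => max_le (abs_nonneg _) (by linarith [le_abs_self (w x)])) hRR hR hc hηR hcR hA
    have hp : 0 ≤ c ^ ((N : ℝ) + 2 * s) := Real.rpow_nonneg hc.le _
    have hah : 0 ≤ a * (k' - k)⁻¹ := by positivity
    have e2 : (2 : ℝ≥0∞) = ENNReal.ofReal 2 := by simp
    calc gagliardoEnergy s (fun x => η x * max 0 (w x - k'))
        ≤ ENNReal.ofReal F * ENNReal.ofReal (a * (k' - k)⁻¹)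
          + (2 * (ENNReal.ofReal a * ENNReal.ofReal A) + 2 * (ENNReal.ofReal (a * (k' - k)⁻¹)
            * (ENNReal.ofReal (c ^ ((N : ℝ) + 2 * s)) * ENNReal.ofReal T))) := by
          refine h1.trans (add_le_add (by gcongr) (h2.trans ?_))
          gcongr
      _ = ENNReal.ofReal (F * (a * (k' - k)⁻¹) + (2 * (a * A)
            + 2 * (a * (k' - k)⁻¹ * (c ^ ((N : ℝ) + 2 * s) * T)))) := by
          rw [e2, ← ENNReal.ofReal_mul hF, ← ENNReal.ofReal_mul ha, ← ENNReal.ofReal_mul hp,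
            ← ENNReal.ofReal_mul hah, ← ENNReal.ofReal_mul zero_le_two,
            ← ENNReal.ofReal_mul zero_le_two, ← ENNReal.ofReal_add (by positivity) (by positivity),
            ← ENNReal.ofReal_add (by positivity) (by positivity)]
      _ ≤ ENNReal.ofReal (D * a) := by
          refine ENNReal.ofReal_le_ofReal ((mul_le_mul_of_nonneg_right hD ha).trans' (le_of_eq ?_))
          rw [div_eq_mul_inv]
          ring
  -- Chebyshev's inequality for `(w - k)₊²` at height `(k' - k)²`.
  have hvol : volume (ball x₀ R ∩ {x | k' < w x})
      ≤ ENNReal.ofReal (halfUnitBallVolume N * σ ^ N) := by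
    have hm : MeasurableSet (ball x₀ R ∩ {x | k' < w x}) :=
      measurableSet_ball.inter (measurableSet_lt measurable_const hwm)
    have h1 : ENNReal.ofReal ((k' - k) ^ 2) * volume (ball x₀ R ∩ {x | k' < w x})
        ≤ ENNReal.ofReal a := by
      rw [← setLIntegral_const]
      refine le_trans (setLIntegral_mono' hm fun x hx => ENNReal.ofReal_le_ofReal ?_)
        ((lintegral_mono_set Set.inter_subset_left).trans hY)
      have : k' < w x := hx.2
      exact pow_le_pow_left₀ hh.le ((by linarith : k' - k ≤ w x - k).trans (le_max_right _ _)) 2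
    refine le_trans ?_ (ENNReal.ofReal_le_ofReal hσa)
    rw [ENNReal.ofReal_div_of_pos (by positivity), ENNReal.le_div_iff_mul_le
      (Or.inl (ENNReal.ofReal_pos.2 (by positivity)).ne') (Or.inl ENNReal.ofReal_ne_top), mul_comm]
    exact h1
  have hFK := (lintegral_sq_le_gagliardoEnergy (u := fun x => η x * max 0 (w x - k'))
    (by fun_prop) hs0 (S := ball x₀ R ∩ {x | k' < w x})
    (measurableSet_ball.inter (measurableSet_lt measurable_const hwm)) (fun x hx => by
      by_cases hxR : x ∈ ball x₀ R
      · have : w x ≤ k' := not_lt.1 fun h => hx ⟨hxR, h⟩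
        rw [max_eq_left (by linarith), mul_zero]
      · simp [hout x hxR]) hσ hvol).trans hE
  have hX : ∫⁻ x in ball x₀ ρ, ENNReal.ofReal (max 0 (w x - k') ^ 2)
      ≤ ∫⁻ x, ENNReal.ofReal ((η x * max 0 (w x - k')) ^ 2) := by
    refine le_trans (le_of_eq (setLIntegral_congr_fun measurableSet_ball fun x hx => ?_))
      (setLIntegral_le_lintegral (ball x₀ ρ) _)
    simp only [hηρ x hx, one_mul]
  refine hX.trans ?_
  have hpos : 0 < halfUnitBallVolume N * σ ^ (-(2 * s)) := by positivity
  calc _ = ENNReal.ofReal (halfUnitBallVolume N * σ ^ (-(2 * s)))⁻¹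
        * (ENNReal.ofReal (halfUnitBallVolume N * σ ^ (-(2 * s)))
          * ∫⁻ x, ENNReal.ofReal ((η x * max 0 (w x - k')) ^ 2)) := by
        rw [← mul_assoc, ← ENNReal.ofReal_mul (inv_nonneg.2 hpos.le), inv_mul_cancel₀ hpos.ne',
          ENNReal.ofReal_one, one_mul]
    _ ≤ ENNReal.ofReal (halfUnitBallVolume N * σ ^ (-(2 * s)))⁻¹ * ENNReal.ofReal (D * a) := by
        gcongr
    _ = _ := by
        rw [← ENNReal.ofReal_mul (inv_nonneg.2 hpos.le), mul_inv, Real.rpow_neg hσ.le, inv_inv]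
        congr 1
        ring

set_option maxHeartbeats 1000000 in
/-- The conclusion of the De Giorgi iteration: a subsolution is at most `l` on the half ball, if
`l` dominates the data and the mean square of the subsolution is small compared to `l ^ 2`. -/
theorem exists_ae_le_of_lintegral_sq_le (N : ℕ) (hN : 1 ≤ N) (hs0 : 0 < s) (hs1 : s < 1) :
    ∃ θ : ℝ, 0 < θ ∧ ∀ (U : Set (EuclideanSpace ℝ (Fin N))) (x₀ : EuclideanSpace ℝ (Fin N))
      (δ r F T l : ℝ) (w : EuclideanSpace ℝ (Fin N) → ℝ), 0 < δ → δ ≤ 1 → 0 < r →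
      closedBall x₀ r ⊆ U → Measurable w → MemHomogeneousSobolev s w →
      (∀ φ : EuclideanSpace ℝ (Fin N) → ℝ, IsTestFunction U φ → (∀ x, 0 ≤ φ x) →
        gagliardoForm s w φ ≤ F * ∫ x, φ x) → 0 ≤ F → 0 ≤ T → 0 < l →
      δ * T ≤ l → δ * r ^ (2 * s) * F ≤ l →
      ∫⁻ x in (ball x₀ (r / 2))ᶜ, ENNReal.ofReal (|w x| * fracKernel s x x₀)
        ≤ ENNReal.ofReal (4 * r ^ (-(2 * s)) * T) →
      ∫⁻ x in ball x₀ r, ENNReal.ofReal (w x ^ 2)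
        ≤ ENNReal.ofReal (θ * δ ^ ((N : ℝ) / (2 * s)) * l ^ 2 * r ^ N) →
      ∀ᵐ x ∂(volume.restrict (ball x₀ (r / 2))), w x ≤ l := by
  obtain ⟨C₀, hC₀, hC⟩ := exists_lintegral_min_mul_fracKernel_le hN hs0 hs1
  obtain ⟨L, hL0, hL⟩ := exists_cutoff N
  have hκ := halfUnitBallVolume_pos N
  set κ := halfUnitBallVolume N with hκdef
  obtain ⟨P, hP⟩ : ∃ t : ℝ, t = (N : ℝ) + 2 * s := ⟨_, rfl⟩
  have hP0 : 0 < P := by rw [hP]; positivity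
  -- `b ^ n` absorbs every growth in `n`: `2 ^ n` from the gap between levels times `(2 ^ P) ^ n`
  -- from the kernel comparison, and `4 ^ n` from the squared slope of the cutoff.
  obtain ⟨b, hb⟩ : ∃ t : ℝ, t = 4 * 2 ^ P := ⟨_, rfl⟩
  have hb0 : 0 < b := by rw [hb]; positivity
  have h2P : (1 : ℝ) ≤ 2 ^ P := Real.one_le_rpow (by norm_num) hP0.le
  have hb1 : 1 < b := by linarith
  obtain ⟨C₁, hC₁⟩ : ∃ t : ℝ, t = (2 + 16 * 8 ^ P) + 2 * ((1 + 64 * L ^ 2) * C₀) := ⟨_, rfl⟩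
  have hC₁0 : 0 < C₁ := by rw [hC₁]; positivity
  obtain ⟨α, hα⟩ : ∃ t : ℝ, t = (N : ℝ) / (2 * s) := ⟨_, rfl⟩
  have hα0 : 0 < α := by
    have : (0 : ℝ) < N := by exact_mod_cast hN
    rw [hα]
    positivity
  -- With this `q`, `(b ^ n) ^ (-α) = 4 ^ n * q ^ n`: the decay of `σ ^ N` exactly matches `q ^ n`
  -- divided by the squared gap between levels.
  obtain ⟨q, hq⟩ : ∃ t : ℝ, t = b ^ (-α) / 4 := ⟨_, rfl⟩
  have hq0 : 0 < q := by rw [hq]; positivity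
  have hq1 : q < 1 := by
    have : b ^ (-α) ≤ 1 := Real.rpow_le_one_of_one_le_of_nonpos hb1.le (by linarith)
    rw [hq]
    linarith
  refine ⟨κ / 4 * (q * κ / C₁) ^ α, by positivity, ?_⟩
  intro U x₀ δ r F T l w hδ0 hδ1 hr hU hwm hw hsub hF hT hl hδT hδF htail hY₀
  rw [← hα] at hY₀
  obtain ⟨a, ha⟩ : ∃ t : ℕ → ℝ, t = fun n => κ / 4 * (q * κ / C₁) ^ α * δ ^ α * l ^ 2 * r ^ N * q ^ n := ⟨_, rfl⟩
  have ha0 : ∀ n, 0 ≤ a n := fun n => by rw [ha]; positivity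
  obtain ⟨e, he⟩ : ∃ t : ℕ → ℝ, t = fun n => (1 / 2) ^ n := ⟨_, rfl⟩
  have he0 : ∀ n, 0 < e n := fun n => by rw [he]; positivity
  have he1 : ∀ n, e n ≤ 1 := fun n => by
    rw [he]
    exact pow_le_one₀ (by norm_num) (by norm_num)
  have hes : ∀ n, e (n + 1) = e n / 2 := fun n => by
    simp only [he]
    rw [pow_succ]
    ring
  have he2 : ∀ n, e n * 2 ^ n = 1 := fun n => by
    simp only [he]
    rw [← mul_pow]
    norm_num
  have main : ∀ n : ℕ, ∫⁻ x in ball x₀ (r / 2 * (1 + e n)),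
      ENNReal.ofReal (max 0 (w x - l * (1 - e n)) ^ 2) ≤ ENNReal.ofReal (a n) := by
    intro n
    induction n with
    | zero =>
      have h0 : r / 2 * (1 + e 0) = r := by simp only [he]; ring
      have h1 : l * (1 - e 0) = 0 := by simp [he]
      rw [h0, h1]
      refine le_trans (lintegral_mono fun x => ENNReal.ofReal_le_ofReal ?_)
        (hY₀.trans (ENNReal.ofReal_le_ofReal (le_of_eq ?_)))
      · rw [sub_zero, ← sq_abs (w x)]
        exact pow_le_pow_left₀ (le_max_left _ _) (max_le (abs_nonneg _) (le_abs_self _)) 2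
      · simp [ha]
    | succ n ih =>
      have hen := he0 n
      have hen1 := he1 n
      have hre : 0 < r * e n := by positivity
      have hre1 : r * e n ≤ r := mul_le_of_le_one_right hr.le hen1
      -- The cutoff stops midway between the consecutive radii (`3/4` is the mean of `1/2` and `1`),
      -- leaving room for the tail comparison.
      obtain ⟨η, hηt, hη0, hη1, hηρ, hηR, hηL⟩ := hL x₀ (r / 2 * (1 + e (n + 1)))
        (r / 2 * (1 + 3 / 4 * e n)) (by have := he0 (n + 1); positivity)
        (by rw [hes]; linarith)
      have hdiff : r / 2 * (1 + 3 / 4 * e n) - r / 2 * (1 + e (n + 1)) = r * e n / 8 := by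
        rw [hes]
        ring
      rw [hdiff] at hηL
      have hηU : IsTestFunction U η := by
        refine ⟨hηt.1, hηt.2.1, hηt.2.2.trans (subset_trans (closedBall_subset_closedBall ?_) hU)⟩
        linarith
      obtain ⟨m, hm⟩ : ∃ t : ℝ, t = (1 + 64 * L ^ 2) * 4 ^ n := ⟨_, rfl⟩
      have h4 : (4 : ℝ) ^ n = 2 ^ n * 2 ^ n := by rw [← mul_pow]; norm_num
      have h4e : e n ^ 2 * 4 ^ n = 1 := by
        rw [h4, show e n ^ 2 * (2 ^ n * 2 ^ n) = (e n * 2 ^ n) ^ 2 by ring, he2, one_pow]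
      have hmin := sq_sub_le_mul_min (M := 1) (m := m) hr hηL
        (fun x y => abs_sub_le_iff.2 ⟨by linarith [hη1 x, hη0 y], by linarith [hη1 y, hη0 x]⟩)
        (by
          rw [hm]
          have h64 : (L / (r * e n / 8)) ^ 2 * r ^ 2 = 64 * L ^ 2 * 4 ^ n := by
            rw [div_pow, div_mul_eq_mul_div, div_eq_iff (by positivity)]
            linear_combination (-(L ^ 2 * r ^ 2)) * h4e
          rw [h64]
          have : (0 : ℝ) < 4 ^ n := by positivity
          linarith)
        (by
          rw [hm]
          have : (1 : ℝ) ≤ 4 ^ n := one_le_pow₀ (by norm_num)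
          rw [one_pow]
          exact one_le_mul_of_one_le_of_one_le (by linarith [sq_nonneg L]) this)
      have hm0 : 0 ≤ m := by rw [hm]; positivity
      have hA := fun x => lintegral_sq_sub_mul_fracKernel_le (hC r hr x) (hmin x) hm0
      have hbn : 0 < b ^ n := by positivity
      -- `G` is chosen so that the contraction factor `κ⁻¹ σ ^ (2s) D` of one step equals `q`.
      obtain ⟨G, hG⟩ : ∃ t : ℝ, t = q * κ * δ / C₁ := ⟨_, rfl⟩
      have hG0 : 0 < G := by rw [hG]; positivity
      obtain ⟨σ, hσ⟩ : ∃ t : ℝ, t = r * G ^ (1 / (2 * s)) * (b ^ n) ^ (-(1 / (2 * s))) := ⟨_, rfl⟩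
      have hσ0 : 0 < σ := by rw [hσ]; positivity
      have hσ2 : σ ^ (2 * s) = r ^ (2 * s) * G * (b ^ n)⁻¹ := by
        rw [hσ, Real.mul_rpow (by positivity) (by positivity),
          Real.mul_rpow (by positivity) (by positivity), ← Real.rpow_mul hG0.le,
          ← Real.rpow_mul hbn.le, neg_mul, one_div_mul_cancel (by positivity), Real.rpow_one,
          Real.rpow_neg_one]
      have hσN : σ ^ N = r ^ N * G ^ α * (b ^ n) ^ (-α) := by
        rw [hσ, mul_pow, mul_pow, ← Real.rpow_natCast (G ^ (1 / (2 * s))),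
          ← Real.rpow_natCast ((b ^ n) ^ (-(1 / (2 * s)))), ← Real.rpow_mul hG0.le,
          ← Real.rpow_mul hbn.le, hα]
        congr 2
        · congr 1
          ring
        · ring
      have hlev : l * (1 - e (n + 1)) - l * (1 - e n) = l * e n / 2 := by
        rw [hes]
        ring
      have hlen : 0 < l * e n / 2 := by positivity
      have hrad : r / 2 ≤ r / 2 * (1 + e n) := by linarith
      have hstep := lintegral_posPart_sq_le_of_step hN hs0 hs1 hwm hw hsub hF hηU hη0 hη1
        (x₀ := x₀) (ρ := r / 2 * (1 + e (n + 1))) (R' := r / 2 * (1 + 3 / 4 * e n))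
        (R := r / 2 * (1 + e n)) (c := 8 * 2 ^ n) (k := l * (1 - e n))
        (k' := l * (1 - e (n + 1))) (A := m * (C₀ * r ^ (-(2 * s))))
        (T := 4 * r ^ (-(2 * s)) * T) (a := a n) (σ := σ)
        (D := r ^ (-(2 * s)) / δ * (C₁ * b ^ n))
        (by linarith) (by positivity) (by positivity) hηR hηρ
        (fun x hx y hy => ?_) hA (by positivity) (by positivity) ?_ ?_
        (mul_nonneg hl.le (by linarith)) (by linarith) (ha0 n) ih hσ0 ?_ ?_
      · refine hstep.trans (ENNReal.ofReal_le_ofReal (le_of_eq ?_))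
        rw [hσ2, hG, Real.rpow_neg hr.le]
        have hr2 : r ^ (2 * s) ≠ 0 := (Real.rpow_pos_of_pos hr _).ne'
        have : a (n + 1) = q * a n := by
          simp only [ha]
          rw [pow_succ]
          ring
        rw [this, ← hκdef]
        field_simp
      -- The worst ratio is the outer radius over the gap, `4 (1 + e n) / e n`, and this is at most
      -- `8 / e n = 8 * 2 ^ n`.
      · rw [mem_ball, dist_eq_norm] at hx
        rw [mem_ball, not_lt, dist_comm, dist_eq_norm] at hy
        have h1 : ‖x₀ - y‖ ≤ ‖x - x₀‖ + ‖x - y‖ := by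
          rw [show x₀ - y = -(x - x₀) + (x - y) by abel]
          exact (norm_add_le _ _).trans (by rw [norm_neg])
        have h2 : (1 : ℝ) ≤ 2 ^ n := one_le_pow₀ (by norm_num)
        have h3 : 8 * (2 : ℝ) ^ n * (‖x₀ - y‖ - r / 2 * (1 + 3 / 4 * e n)) ≤ 8 * 2 ^ n * ‖x - y‖ :=
          mul_le_mul_of_nonneg_left (by linarith) (by positivity)
        have h5 : (8 * (2 : ℝ) ^ n - 1) * (r / 2 * (1 + e n)) ≤ (8 * 2 ^ n - 1) * ‖x₀ - y‖ :=
          mul_le_mul_of_nonneg_left hy (by linarith)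
        have h6 : 8 * (2 : ℝ) ^ n * (r / 2 * (1 + e n)) - 8 * 2 ^ n * (r / 2 * (1 + 3 / 4 * e n))
            = r := by linear_combination r * he2 n
        linarith
      · exact (lintegral_mono_set (Set.compl_subset_compl.2 (ball_subset_ball hrad))).trans htail
      · refine lt_of_le_of_lt (lintegral_mono_set (ball_subset_ball ?_))
          (hY₀.trans_lt ENNReal.ofReal_lt_top)
        linarith
      -- The measure condition holds with equality; this is what fixes `θ` and the power of `δ` in
      -- the initial smallness.
      · rw [hlev, hσN, div_le_iff₀ (by positivity)]
        refine le_of_eq ?_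
        have h1 : (b ^ n) ^ (-α) = 4 ^ n * q ^ n := by
          rw [← mul_pow, hq, mul_div_cancel₀ _ (by norm_num : (4 : ℝ) ≠ 0), ← Real.rpow_natCast,
            ← Real.rpow_natCast, ← Real.rpow_mul hb0.le, ← Real.rpow_mul hb0.le, mul_comm]
        have h2 : G ^ α = (q * κ / C₁) ^ α * δ ^ α := by
          rw [← Real.mul_rpow (by positivity) hδ0.le, hG]
          congr 1
          ring
        rw [h1, h2]
        simp only [ha]
        linear_combination (-(κ / 4 * (q * κ / C₁) ^ α * δ ^ α * l ^ 2 * r ^ N * q ^ n)) * h4e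
      -- Source and tail are at most `l / δ` in their natural units, and the `l` cancels against the
      -- gap between levels. The cutoff term has no `δ`, and `δ ≤ 1` inserts one.
      · rw [hlev, ← hP]
        have hrs : 0 < r ^ (-(2 * s)) := Real.rpow_pos_of_pos hr _
        have hTl : T ≤ l / δ := by rwa [le_div_iff₀ hδ0, mul_comm]
        have hFl : F ≤ l * r ^ (-(2 * s)) / δ := by
          rw [le_div_iff₀ hδ0, Real.rpow_neg hr.le, ← div_eq_mul_inv,
            le_div_iff₀ (Real.rpow_pos_of_pos hr _)]
          linarith
        have hcP : (8 * (2 : ℝ) ^ n) ^ P = 8 ^ P * (2 ^ P) ^ n := by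
          rw [Real.mul_rpow (by norm_num) (by positivity), ← Real.rpow_natCast,
            ← Real.rpow_natCast, ← Real.rpow_mul (by norm_num), ← Real.rpow_mul (by norm_num),
            mul_comm P]
        have h2n : (1 : ℝ) ≤ (2 ^ P) ^ n := one_le_pow₀ h2P
        have h8 : (0 : ℝ) < 8 ^ P := by positivity
        have hbb : b ^ n = 2 ^ n * 2 ^ n * (2 ^ P) ^ n := by rw [hb, mul_pow, h4]
        have hn1 : (1 : ℝ) ≤ 2 ^ n := one_le_pow₀ (by norm_num)
        have e1 : (F + 2 * (8 * 2 ^ n) ^ P * (4 * r ^ (-(2 * s)) * T)) / (l * e n / 2)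
            ≤ r ^ (-(2 * s)) / δ * ((2 + 16 * 8 ^ P) * b ^ n) := by
          rw [div_le_iff₀ hlen, hcP]
          calc F + 2 * (8 ^ P * (2 ^ P) ^ n) * (4 * r ^ (-(2 * s)) * T)
              ≤ l * r ^ (-(2 * s)) / δ
                + 2 * (8 ^ P * (2 ^ P) ^ n) * (4 * r ^ (-(2 * s)) * (l / δ)) := by gcongr
            _ = l * r ^ (-(2 * s)) / δ * (1 + 8 * 8 ^ P * (2 ^ P) ^ n) := by ring
            _ ≤ l * r ^ (-(2 * s)) / δ * ((1 + 8 * 8 ^ P) * (2 ^ P) ^ n * 2 ^ n) := by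
                gcongr
                have h9 : 1 + 8 * (8 : ℝ) ^ P * ((2 : ℝ) ^ P) ^ n ≤ (1 + 8 * 8 ^ P) * (2 ^ P) ^ n := by
                  linarith
                exact h9.trans (le_mul_of_one_le_right (by positivity) hn1)
            _ = _ := by
                rw [hbb]
                linear_combination (-(l * r ^ (-(2 * s)) / δ * ((1 + 8 * 8 ^ P) * (2 ^ P) ^ n
                  * 2 ^ n))) * he2 n
        have e2 : 2 * (m * (C₀ * r ^ (-(2 * s))))
            ≤ r ^ (-(2 * s)) / δ * (2 * ((1 + 64 * L ^ 2) * C₀) * b ^ n) := by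
          have h10 : (4 : ℝ) ^ n ≤ b ^ n := by
            rw [hbb, ← h4]
            exact le_mul_of_one_le_right (by positivity) h2n
          have h11 : r ^ (-(2 * s)) ≤ r ^ (-(2 * s)) / δ := le_div_self hrs.le hδ0 hδ1
          calc 2 * (m * (C₀ * r ^ (-(2 * s))))
              = r ^ (-(2 * s)) * (2 * ((1 + 64 * L ^ 2) * C₀) * 4 ^ n) := by rw [hm]; ring
            _ ≤ _ := by gcongr
        calc _ ≤ _ := add_le_add e1 e2
          _ = _ := by rw [hC₁]; ring
  have hzero : ∫⁻ x in ball x₀ (r / 2), ENNReal.ofReal (max 0 (w x - l) ^ 2) = 0 := by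
    have hlim : Tendsto (fun n => ENNReal.ofReal (a n)) atTop (𝓝 0) := by
      have h1 := (tendsto_pow_atTop_nhds_zero_of_lt_one hq0.le hq1).const_mul
        (κ / 4 * (q * κ / C₁) ^ α * δ ^ α * l ^ 2 * r ^ N)
      rw [mul_zero] at h1
      have h2 := ENNReal.tendsto_ofReal h1
      rw [ENNReal.ofReal_zero] at h2
      rw [ha]
      exact h2
    -- Every ball of the iteration contains the half ball and every level lies below `l`.
    refine le_antisymm (ge_of_tendsto' hlim fun n => le_trans ?_ (main n)) zero_le
    have hen := he0 n
    refine (lintegral_mono_set (ball_subset_ball (by nlinarith))).trans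
      (lintegral_mono fun x => ENNReal.ofReal_le_ofReal ?_)
    refine pow_le_pow_left₀ (le_max_left _ _) (max_le_max le_rfl ?_) 2
    nlinarith
  rw [lintegral_eq_zero_iff (by fun_prop)] at hzero
  filter_upwards [hzero] with x hx
  by_contra h
  have h1 : 0 < w x - l := by linarith
  have h2 : max 0 (w x - l) ^ 2 ≤ 0 := ENNReal.ofReal_eq_zero.1 hx
  rw [max_eq_right h1.le] at h2
  nlinarith

end DeGiorgi

/-! ### Reduction of the theorem to the iteration. -/

section LocalBoundedness

/-- The ball is connected and meets `U`, so if it left `U` it would meet the frontier within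
distance `r`. -/
theorem closedBall_subset_of_lt_infEDist_frontier {E : Type*} [NormedAddCommGroup E]
    [NormedSpace ℝ E] {U : Set E} (hU : IsOpen U) {x : E} (hx : x ∈ U) {r : ℝ} (hr0 : 0 < r)
    (hr : ENNReal.ofReal r < infEDist x (frontier U)) : closedBall x r ⊆ U := by
  by_contra h
  obtain ⟨y, hy, hyU⟩ := Set.not_subset.1 h
  obtain ⟨z, hz, hzU⟩ : (closedBall x r ∩ frontier U).Nonempty := by
    by_contra hne
    have hcl : ∀ z ∈ closedBall x r, z ∉ U → z ∈ (closure U)ᶜ := fun z hz hzU hzc =>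
      hne ⟨z, hz, hU.frontier_eq ▸ ⟨hzc, hzU⟩⟩
    obtain ⟨z, -, hz, hz'⟩ := (convex_closedBall x r).isPreconnected U (closure U)ᶜ hU
      isClosed_closure.isOpen_compl
      (fun z hz => (em (z ∈ U)).imp_right (hcl z hz))
      ⟨x, mem_closedBall_self hr0.le, hx⟩ ⟨y, hy, hcl y hy hyU⟩
    exact hz' (subset_closure hz)
  refine hr.not_ge ((infEDist_le_edist_of_mem hzU).trans ?_)
  rw [edist_comm, edist_dist]
  exact ENNReal.ofReal_le_ofReal hz

variable {N : ℕ} {s : ℝ}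

theorem IsWeakSubsolution.gagliardoForm_le {U : Set (EuclideanSpace ℝ (Fin N))}
    {f w : EuclideanSpace ℝ (Fin N) → ℝ} (hf : MemLp f ∞ (volume.restrict U))
    (hw : IsWeakSubsolution s U f w) {φ : EuclideanSpace ℝ (Fin N) → ℝ} (hφ : IsTestFunction U φ)
    (hφ0 : ∀ x, 0 ≤ φ x) :
    gagliardoForm s w φ ≤ (eLpNorm f ⊤ (volume.restrict U)).toReal * ∫ x, φ x := by
  have hφi : Integrable φ := hφ.1.continuous.integrable_of_hasCompactSupport hφ.2.1
  have hfb : ∀ᵐ x ∂(volume.restrict U), ‖f x‖ ≤ (eLpNorm f ⊤ (volume.restrict U)).toReal := by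
    filter_upwards [ae_le_eLpNormEssSup (f := f) (μ := volume.restrict U)] with x hx
    rw [← toReal_enorm]
    exact ENNReal.toReal_mono hf.2.ne (by rwa [eLpNorm_exponent_top])
  calc gagliardoForm s w φ ≤ ∫ x in U, f x * φ x := hw.2 φ hφ hφ0
    _ ≤ ‖∫ x in U, f x * φ x‖ := Real.le_norm_self _
    _ ≤ ∫ x in U, (eLpNorm f ⊤ (volume.restrict U)).toReal * φ x := by
        refine norm_integral_le_of_norm_le (hφi.integrableOn.const_mul _) ?_
        filter_upwards [hfb] with x hx
        rw [norm_mul, Real.norm_of_nonneg (hφ0 x)]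
        exact mul_le_mul_of_nonneg_right hx (hφ0 x)
    _ ≤ _ := by
        rw [integral_const_mul]
        exact mul_le_mul_of_nonneg_left (setIntegral_le_integral hφi (Eventually.of_forall hφ0))
          ENNReal.toReal_nonneg

/-- The `4` bounds `2 ^ (2s)`, which comes from the radius `r / 2` in the tail. -/
theorem lintegral_compl_ball_le_of_nonlocalTail (hs1 : s < 1)
    {w : EuclideanSpace ℝ (Fin N) → ℝ}
    {x₀ : EuclideanSpace ℝ (Fin N)} {r : ℝ} (hr : 0 < r) (hT : nonlocalTail s w x₀ (r / 2) ≠ ⊤) :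
    ∫⁻ x in (ball x₀ (r / 2))ᶜ, ENNReal.ofReal (|w x| * fracKernel s x x₀)
      ≤ ENNReal.ofReal (4 * r ^ (-(2 * s)) * (nonlocalTail s w x₀ (r / 2)).toReal) := by
  have hp : 0 < (r / 2) ^ (2 * s) := by positivity
  have hle : ((r / 2) ^ (2 * s))⁻¹ ≤ 4 * r ^ (-(2 * s)) := by
    rw [Real.div_rpow hr.le zero_le_two, inv_div, Real.rpow_neg hr.le, ← div_eq_mul_inv]
    gcongr
    calc (2 : ℝ) ^ (2 * s) ≤ 2 ^ (2 : ℝ) :=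
          Real.rpow_le_rpow_of_exponent_le one_le_two (by linarith)
      _ = 4 := by norm_num
  calc ∫⁻ x in (ball x₀ (r / 2))ᶜ, ENNReal.ofReal (|w x| * fracKernel s x x₀)
      = ENNReal.ofReal ((r / 2) ^ (2 * s))⁻¹ * nonlocalTail s w x₀ (r / 2) := by
        rw [nonlocalTail, ← mul_assoc, ← ENNReal.ofReal_mul (inv_nonneg.2 hp.le),
          inv_mul_cancel₀ hp.ne', ENNReal.ofReal_one, one_mul]
    _ ≤ ENNReal.ofReal (4 * r ^ (-(2 * s))) * nonlocalTail s w x₀ (r / 2) := by gcongr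
    _ = _ := by
        rw [ENNReal.ofReal_mul (p := 4 * r ^ (-(2 * s))) (by positivity), ENNReal.ofReal_toReal hT]

end LocalBoundedness

theorem mainTheorem11 (N : ℕ) (hN : 1 ≤ N) (s : ℝ) (hs0 : 0 < s) (hs1 : s < 1) :
    ∃ C : ℝ, 0 < C ∧
      ∀ (U : Set (EuclideanSpace ℝ (Fin N))) (_hU : IsOpen U)
        (x₀ : EuclideanSpace ℝ (Fin N)) (_hx₀ : x₀ ∈ U)
        (δ : ℝ) (_hδ0 : 0 < δ) (_hδ1 : δ ≤ 1)
        (r : ℝ) (_hr0 : 0 < r) (_hr : ENNReal.ofReal r < infEDist x₀ (frontier U))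
        (f : EuclideanSpace ℝ (Fin N) → ℝ) (_hf : MemLp f ∞ (volume.restrict U))
        (w : EuclideanSpace ℝ (Fin N) → ℝ) (_hw : IsWeakSubsolution s U f w)
        (_hw0 : ∀ᵐ x ∂(volume.restrict U), 0 ≤ w x),
        essSup (fun x => ENNReal.ofReal (w x)) (volume.restrict (ball x₀ (r / 2))) ≤
          ENNReal.ofReal C *
            (ENNReal.ofReal δ * nonlocalTail s w x₀ (r / 2)
              + ENNReal.ofReal (δ * r ^ (2 * s)) * eLpNorm f ∞ (volume.restrict U)
              + ENNReal.ofReal ((1 / δ) ^ ((N : ℝ) / (4 * s))) *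
                (⨍⁻ x in ball x₀ r, ENNReal.ofReal (w x ^ 2) ∂volume) ^ (1 / 2 : ℝ)) := by
  obtain ⟨θ, hθ, H⟩ := exists_ae_le_of_lintegral_sq_le N hN hs0 hs1
  have hκ := halfUnitBallVolume_pos N
  -- The `1` lets `l` dominate the tail and source terms; the root turns the mean over the ball, of
  -- volume `2 κ r ^ N`, into the smallness condition with constant `θ`.
  refine ⟨1 + √(2 * halfUnitBallVolume N / θ), by positivity, ?_⟩
  intro U hU x₀ hx₀ δ hδ0 hδ1 r hr0 hr f hf w hw _
  set κ := halfUnitBallVolume N with hκdef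
  have hCpos : 0 < 1 + √(2 * κ / θ) := by positivity
  have hC0 : ENNReal.ofReal (1 + √(2 * κ / θ)) ≠ 0 := (ENNReal.ofReal_pos.2 hCpos).ne'
  have hδpos : 0 < (1 / δ) ^ ((N : ℝ) / (4 * s)) := by positivity
  rcases eq_or_ne (nonlocalTail s w x₀ (r / 2)) ⊤ with hτ | hτ
  · rw [hτ, ENNReal.mul_top (ENNReal.ofReal_pos.2 hδ0).ne', top_add, top_add, ENNReal.mul_top hC0]
    exact le_top
  rcases eq_or_ne (⨍⁻ x in ball x₀ r, ENNReal.ofReal (w x ^ 2) ∂volume) ⊤ with hav | hav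
  · rw [hav, ENNReal.top_rpow_of_pos (by norm_num), ENNReal.mul_top (ENNReal.ofReal_pos.2 hδpos).ne',
      add_top, ENNReal.mul_top hC0]
    exact le_top
  have hwae := hw.1.aemeasurable.ae_eq_mk
  -- The iteration needs a measurable function; the form, the tail and the averages do not see the
  -- change on a null set.
  set w' := hw.1.aemeasurable.mk w with hw'
  have hw'm : Measurable w' := hw.1.aemeasurable.measurable_mk
  have htail := lintegral_compl_ball_le_of_nonlocalTail hs1 hr0 hτ
  have hsub : ∀ φ : EuclideanSpace ℝ (Fin N) → ℝ, IsTestFunction U φ → (∀ x, 0 ≤ φ x) →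
      gagliardoForm s w' φ ≤ (eLpNorm f ⊤ (volume.restrict U)).toReal * ∫ x, φ x :=
    fun φ hφ hφ0 => by
      rw [← gagliardoForm_congr_ae hwae]
      exact hw.gagliardoForm_le hf hφ hφ0
  have hFtop : eLpNorm f ⊤ (volume.restrict U) ≠ ⊤ := hf.2.ne
  rw [← ENNReal.ofReal_toReal hτ, ← ENNReal.ofReal_toReal hFtop, ← ENNReal.ofReal_toReal hav]
  have hsq : ∫⁻ x in ball x₀ r, ENNReal.ofReal (w x ^ 2)
      = ENNReal.ofReal ((⨍⁻ x in ball x₀ r, ENNReal.ofReal (w x ^ 2) ∂volume).toReal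
        * (2 * (κ * r ^ N))) := by
    rw [ENNReal.ofReal_mul ENNReal.toReal_nonneg, ENNReal.ofReal_toReal hav, setLAverage_eq,
      ← volume_ball_eq_halfUnitBallVolume x₀ hr0,
      ENNReal.div_mul_cancel (measure_ball_pos _ _ hr0).ne' measure_ball_lt_top.ne]
  have hT0 : 0 ≤ (nonlocalTail s w x₀ (r / 2)).toReal := ENNReal.toReal_nonneg
  have hF0 : 0 ≤ (eLpNorm f ⊤ (volume.restrict U)).toReal := ENNReal.toReal_nonneg
  have ha0 : 0 ≤ (⨍⁻ x in ball x₀ r, ENNReal.ofReal (w x ^ 2) ∂volume).toReal :=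
    ENNReal.toReal_nonneg
  generalize (nonlocalTail s w x₀ (r / 2)).toReal = T at htail hT0 ⊢
  generalize (eLpNorm f ⊤ (volume.restrict U)).toReal = F at hsub hF0 ⊢
  generalize (⨍⁻ x in ball x₀ r, ENNReal.ofReal (w x ^ 2) ∂volume).toReal = a at hsq ha0 ⊢
  have hrs : 0 < r ^ (2 * s) := Real.rpow_pos_of_pos hr0 _
  set c := √(2 * κ / θ) with hc
  have hc0 : 0 ≤ c := Real.sqrt_nonneg _
  have hc2 : c ^ 2 * θ = 2 * κ := by
    rw [hc, Real.sq_sqrt (by positivity), div_mul_cancel₀ _ hθ.ne']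
  rw [ENNReal.ofReal_rpow_of_nonneg ha0 (by norm_num), ← ENNReal.ofReal_mul hδ0.le,
    ← ENNReal.ofReal_mul (by positivity), ← ENNReal.ofReal_mul hδpos.le,
    ← ENNReal.ofReal_add (by positivity) (by positivity),
    ← ENNReal.ofReal_add (by positivity) (by positivity), ← ENNReal.ofReal_mul hCpos.le]
  have hd2 : ((1 / δ) ^ ((N : ℝ) / (4 * s))) ^ 2 * δ ^ ((N : ℝ) / (2 * s)) = 1 := by
    rw [← Real.rpow_natCast, ← Real.rpow_mul (by positivity), one_div, Real.inv_rpow hδ0.le,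
      show (N : ℝ) / (4 * s) * (2 : ℕ) = (N : ℝ) / (2 * s) by push_cast; field_simp; ring]
    exact inv_mul_cancel₀ (Real.rpow_pos_of_pos hδ0 _).ne'
  have ha2 : (a ^ (1 / 2 : ℝ)) ^ 2 = a := by
    rw [← Real.rpow_natCast, ← Real.rpow_mul ha0]
    norm_num
  have hα0 : 0 ≤ a ^ (1 / 2 : ℝ) := Real.rpow_nonneg ha0 _
  have hdα : 0 < δ ^ ((N : ℝ) / (2 * s)) := Real.rpow_pos_of_pos hδ0 _
  generalize (1 / δ) ^ ((N : ℝ) / (4 * s)) = d at hδpos hd2 ⊢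
  generalize a ^ (1 / 2 : ℝ) = α at ha2 hα0 ⊢
  -- The iteration requires `l > 0`, while the right-hand side may vanish; `ε` supplies strict
  -- positivity.
  refine ENNReal.le_of_forall_pos_le_add fun ε hε _ => ?_
  have hε' : (0 : ℝ) < ε := hε
  have hsum : 0 ≤ δ * T + δ * r ^ (2 * s) * F + d * α := by positivity
  obtain ⟨l, hl⟩ : ∃ l, l = (1 + c) * (δ * T + δ * r ^ (2 * s) * F + d * α) + ε := ⟨_, rfl⟩
  have n1 : 0 ≤ δ * T := by positivity
  have n2 : 0 ≤ δ * r ^ (2 * s) * F := by positivity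
  have n3 : 0 ≤ d * α := by positivity
  have n4 : 0 ≤ c * (δ * T + δ * r ^ (2 * s) * F) := by positivity
  have n5 : 0 ≤ c * (d * α) := by positivity
  have hae := H U x₀ δ r F T l w' hδ0 hδ1 hr0
    (closedBall_subset_of_lt_infEDist_frontier hU hx₀ hr0 hr) hw'm (hw.1.congr_ae hwae) hsub hF0
    hT0 (by linarith) (by linarith) (by linarith)
    (by
      refine le_trans (le_of_eq (lintegral_congr_ae ?_)) htail
      filter_upwards [ae_restrict_of_ae hwae] with x hx
      rw [hx])
    (by
      refine le_trans (le_of_eq (lintegral_congr_ae ?_))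
        (hsq.le.trans (ENNReal.ofReal_le_ofReal ?_))
      · filter_upwards [ae_restrict_of_ae hwae] with x hx
        rw [hx]
      · have hcl : (c * (d * α)) ^ 2 ≤ l ^ 2 := pow_le_pow_left₀ n5 (by linarith) 2
        calc a * (2 * (κ * r ^ N))
            = θ * δ ^ ((N : ℝ) / (2 * s)) * (c * (d * α)) ^ 2 * r ^ N := by
              linear_combination (-(a * r ^ N)) * hc2 - (θ * c ^ 2 * r ^ N * a) * hd2
                - (θ * c ^ 2 * r ^ N * d ^ 2 * δ ^ ((N : ℝ) / (2 * s))) * ha2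
          _ ≤ _ := by gcongr)
  rw [← ENNReal.ofReal_coe_nnreal, ← ENNReal.ofReal_add (by positivity) hε'.le, ← hl]
  refine essSup_le_of_ae_le _ ?_
  filter_upwards [hae, ae_restrict_of_ae hwae] with x hx hx'
  rw [hx']
  exact ENNReal.ofReal_le_ofReal hx
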